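/- Let $S^\bullet=\mathbb Z[1/4][a,b,\Delta^{-1}]$ with $\Delta=a^2b^4(a^2-16b)$, and let $C$ be the elliptic curve $y^2+axy+aby=x^3+bx^2$ over $S^\bullet$. In the coordinates $u=x/y$, $v=1/y$ around the identity $(u,v)=(0,0)$ its equation is $v+auv+abv^2=u^3+bu^2v$. Put $$S^\bullet_3=S^\bullet[\kappa]\big/\Big(\kappa^4-\tfrac{6}{b^2}\kappa^2+\tfrac{a^2-8b}{b^4}\kappa-\tfrac{3}{b^4}\Big),$$ and over $S^\bullet_3$ let $C'$ be the curve $v+a'uv+a'b'v^2=u^3+b'u^2v$ with $b'=b^3$ and $$a'=\tfrac1a\big((a^2b^4-4b^5)\kappa^3+4b^4\kappa^2+(-6a^2b^2+20b^3)\kappa+a^4-12a^2b+12b^2\big).$$ Let $\psi:C\to C'=C/G$ be the universal isogeny of degree $3$ with source $C$: its kernel $G$ is generated by a point $Q$ of exact order $3$, it is given by $$u(\psi(P))=u(P)\,u(P-Q)\,u(P+Q),\qquad v(\psi(P))=\mu\cdot v(P)\,v(P-Q)\,v(P+Q),$$ where $\mu$ is the scalar that puts the equation of the target into Weierstrass form,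 and $\psi^*$ sends $du$ to $\kappa\,du$ on relative cotangent spaces at the identity. Let $G'=C[3]/G=\psi(C[3])\subset C'$, and let $\psi':C'\to C'/G'$ be the isogeny defined in the same way from a nonzero point $Q'$ of $G'$, with target of the form $v+a''uv+a''b''v^2=u^3+b''u^2v$ with $a'',b''\in S^\bullet_3$. Then such isogenies $\psi$ and $\psi'$ exist over $S^\bullet_3$ (the points $Q$, $Q'$ being taken on the geometric fibres where $3$ is invertible), there is a unique $\kappa'\in S^\bullet_3$ such that $(\psi')^*$ sends $du$ to $\kappa'\,du$ on relative cotangent spaces at the identity, and in $S^\bullet_3$ $$b^4\kappa\kappa'+3=0\qquad\text{and}\qquad \kappa'=-\kappa^3+\frac{6}{b^2}\,\kappa-\frac{a^2-8b}{b^4}.$$ -/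

import Mathlib

namespace FrobIsog

open MvPolynomial

noncomputable section

/-! ### Weierstrass curves with a point of order four, in `uv`-coordinates -/

section Curve

variable {R : Type} [CommRing R]

/-- The Weierstrass curve `y² + a x y + a b y = x³ + b x²`. -/
def curve (a b : R) : WeierstrassCurve R := ⟨a, b, a * b, 0, 0⟩

/-- The equation `v + a u v + a b v² = u³ + b u² v` of the same curve in the coordinates
`u = x / y`, `v = 1 / y` around the identity `(u, v) = (0, 0)`; here `u = X 0` and `v = X 1`. -/
def uvEquation (a b : R) : MvPolynomial (Fin 2) R :=
  X 1 + C a * X 0 * X 1 + C (a * b) * X 1 ^ 2 - (X 0 ^ 3 + C b * X 0 ^ 2 * X 1)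

/-- The coordinate ring of the affine `uv`-chart. -/
abbrev Chart (a b : R) : Type := MvPolynomial (Fin 2) R ⧸ Ideal.span {uvEquation a b}

/-- Restriction of functions on the chart to the identity section `(u, v) = (0, 0)`. -/
def chartAug (a b : R) : Chart a b →ₐ[R] R :=
  Ideal.Quotient.liftₐ (Ideal.span {uvEquation a b}) (MvPolynomial.aeval fun _ => (0 : R)) (by
    intro f hf
    have h : Ideal.span {uvEquation a b} ≤
        RingHom.ker (MvPolynomial.aeval (fun _ => (0 : R)) : MvPolynomial (Fin 2) R →ₐ[R] R) := by
      rw [Ideal.span_singleton_le_iff_mem, RingHom.mem_ker]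
      simp [uvEquation]
    exact h hf)

/-- The functions on the chart that are invertible along the identity section. -/
def unitsAtId (a b : R) : Submonoid (Chart a b) :=
  (IsUnit.submonoid R).comap (chartAug a b : Chart a b →* R)

/-- The ring of germs of functions along the identity section: fractions of functions on the
chart whose denominator is invertible along that section. -/
def Germ (a b : R) : Type := Localization (unitsAtId a b)

instance (a b : R) : CommRing (Germ a b) :=
  inferInstanceAs (CommRing (Localization (unitsAtId a b)))

instance (a b : R) : Algebra (Chart a b) (Germ a b) :=
  inferInstanceAs (Algebra (Chart a b) (Localization (unitsAtId a b)))

instance (a b : R) : IsLocalization (unitsAtId a b) (Germ a b) :=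
  inferInstanceAs (IsLocalization (unitsAtId a b) (Localization (unitsAtId a b)))

instance (a b : R) : Algebra R (Germ a b) :=
  ((algebraMap (Chart a b) (Germ a b)).comp (algebraMap R (Chart a b))).toAlgebra

instance (a b : R) : IsScalarTower R (Chart a b) (Germ a b) :=
  IsScalarTower.of_algebraMap_eq (R := R) (S := Chart a b) (A := Germ a b) fun _ => rfl

/-- The germ of a polynomial in `u` and `v`. -/
def germ (a b : R) (F : MvPolynomial (Fin 2) R) : Germ a b :=
  algebraMap (Chart a b) (Germ a b) (Ideal.Quotient.mk _ F)

/-- Restriction of germs to the identity section. -/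
def germAug (a b : R) : Germ a b →ₐ[R] R :=
  IsLocalization.liftAlgHom (M := unitsAtId a b) (f := chartAug a b) (fun y => y.2)

/-- The ideal of the identity section. -/
def idIdeal (a b : R) : Ideal (Germ a b) := RingHom.ker (germAug a b)

/-- The relative cotangent space at the identity. -/
abbrev CotangentAtId (a b : R) : Type := (idIdeal a b).Cotangent

lemma germ_u_mem (a b : R) : germ a b (X 0) ∈ idIdeal a b := by
  have h1 : germAug a b (germ a b (X 0)) =
      chartAug a b (Ideal.Quotient.mk (Ideal.span {uvEquation a b}) (X 0)) :=
    IsLocalization.lift_eq (M := unitsAtId a b) (S := Germ a b)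
      (g := (chartAug a b : Chart a b →+* R)) (fun y => y.2) _
  have h2 : chartAug a b (Ideal.Quotient.mk (Ideal.span {uvEquation a b}) (X 0)) =
      MvPolynomial.aeval (fun _ => (0 : R)) (X 0 : MvPolynomial (Fin 2) R) := rfl
  rw [idIdeal, RingHom.mem_ker, h1, h2, MvPolynomial.aeval_X]

/-- The cotangent vector `du` at the identity. -/
def du (a b : R) : CotangentAtId a b :=
  (idIdeal a b).toCotangent ⟨germ a b (X 0), germ_u_mem a b⟩

/-- An `R`-morphism, defined in a neighbourhood of the identity section, from the curve with
coefficients `(a, b)` to the curve with coefficients `(a₂, b₂)`, taking identity to identity;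
it is given by pull-back of functions. -/
structure PointedMap (a b a₂ b₂ : R) where
  /-- pull-back of germs of functions -/
  pullback : Germ a₂ b₂ →ₐ[R] Germ a b
  map_id : (germAug a b).comp pullback = germAug a₂ b₂

variable {a b a₂ b₂ : R}

lemma PointedMap.le_comap (ψ : PointedMap a b a₂ b₂) :
    idIdeal a₂ b₂ ≤ (idIdeal a b).comap ψ.pullback := by
  intro g hg
  have h : germAug a b (ψ.pullback g) = germAug a₂ b₂ g := DFunLike.congr_fun ψ.map_id g
  simp only [idIdeal, Ideal.mem_comap, RingHom.mem_ker] at hg ⊢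
  rw [h, hg]

/-- The map induced on relative cotangent spaces at the identity. -/
def PointedMap.cotangentMap (ψ : PointedMap a b a₂ b₂) :
    CotangentAtId a₂ b₂ →ₗ[R] CotangentAtId a b :=
  Ideal.mapCotangent (idIdeal a₂ b₂) (idIdeal a b) ψ.pullback ψ.le_comap

/-- `k` is the cotangent factor of `ψ`: the pull-back of `du` is `k du`. -/
def PointedMap.HasCotangentFactor (ψ : PointedMap a b a₂ b₂) (k : R) : Prop :=
  ψ.cotangentMap (du a₂ b₂) = k • du a b

/-! ### Geometric points -/

variable {K : Type} [Field K]

/-- The `K`-points of the fibre at `φ : R → K` of the curve with coefficients `(a, b)`. -/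
abbrev FibrePoint (φ : R →+* K) (a b : R) : Type := (curve (φ a) (φ b)).toAffine.Point

/-- The point `P` lies in the `uv`-chart and has coordinates `u = x / y`, `v = 1 / y`
(with `u = v = 0` at the identity). -/
def HasUV {W : WeierstrassCurve.Affine K} : W.Point → K → K → Prop
  | .zero, u, v => u = 0 ∧ v = 0
  | .some x y _, u, v => v * y = 1 ∧ u = x * v

/-- The function `g` is regular at the point `(u, v)` of the fibre at `φ`, with value `t`. -/
def GermValue (φ : R →+* K) (g : Germ a b) (u v t : K) : Prop :=
  ∃ F H : MvPolynomial (Fin 2) R, g * germ a b H = germ a b F ∧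
    eval₂ φ ![u, v] H ≠ 0 ∧ eval₂ φ ![u, v] H * t = eval₂ φ ![u, v] F

/-- On the fibre at `φ`, the map `ψ` is defined at the point `P` and takes it to `P₂`. -/
def PointedMap.MapsTo (ψ : PointedMap a b a₂ b₂) (φ : R →+* K)
    (P : FibrePoint φ a b) (P₂ : FibrePoint φ a₂ b₂) : Prop :=
  ∃ u v u₂ v₂ : K, HasUV P u v ∧ HasUV P₂ u₂ v₂ ∧
    GermValue φ (ψ.pullback (germ a₂ b₂ (X 0))) u v u₂ ∧
    GermValue φ (ψ.pullback (germ a₂ b₂ (X 1))) u v v₂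

/-- On the fibre at `φ`, the map `ψ` is given by the point `Q` of order three through
`u(ψ(P)) = u(P) u(P - Q) u(P + Q)` and `v(ψ(P)) = μ v(P) v(P - Q) v(P + Q)`.
The scalar `μ` is the one that puts the equation of the target into Weierstrass form. -/
def PointedMap.IsNormMap [DecidableEq K] (ψ : PointedMap a b a₂ b₂) (φ : R →+* K)
    (Q : FibrePoint φ a b) : Prop :=
  Q ≠ 0 ∧ 3 • Q = 0 ∧ ∃ μ : K, μ ≠ 0 ∧
    ∀ (P : FibrePoint φ a b) (u₀ v₀ u₁ v₁ u₂ v₂ : K),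
      HasUV P u₀ v₀ → HasUV (P - Q) u₁ v₁ → HasUV (P + Q) u₂ v₂ →
      (∀ t, GermValue φ (ψ.pullback (germ a₂ b₂ (X 0))) u₀ v₀ t → t = u₀ * u₁ * u₂) ∧
      (∀ t, GermValue φ (ψ.pullback (germ a₂ b₂ (X 1))) u₀ v₀ t → t = μ * (v₀ * v₁ * v₂))

end Curve

/-! ### The rings `S` and `S₃`, and the universal curve -/

/-- `ℤ[1/4]` -/
abbrev ZQuarter : Type := Localization.Away (4 : ℤ)

/-- The polynomial `Δ = a² b⁴ (a² - 16 b)`. -/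
def disc : MvPolynomial (Fin 2) ZQuarter := X 0 ^ 2 * X 1 ^ 4 * (X 0 ^ 2 - 16 * X 1)

/-- The ring `ℤ[1/4][a, b, Δ⁻¹]`. -/
abbrev S : Type := Localization.Away disc

def aS : S := algebraMap (MvPolynomial (Fin 2) ZQuarter) S (X 0)

def bS : S := algebraMap (MvPolynomial (Fin 2) ZQuarter) S (X 1)

lemma isUnit_disc : IsUnit (aS ^ 2 * bS ^ 4 * (aS ^ 2 - 16 * bS)) := by
  have h := IsLocalization.Away.algebraMap_isUnit (S := S) disc
  have h16 : algebraMap (MvPolynomial (Fin 2) ZQuarter) S 16 = 16 := map_ofNat _ 16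
  simpa only [disc, aS, bS, map_mul, map_sub, map_pow, h16] using h

/-- `a` and `b` are units, so that `Ring.inverse` below is the actual inverse. -/
lemma isUnit_aS : IsUnit aS := by
  refine isUnit_of_dvd_unit ?_ isUnit_disc
  exact Dvd.intro (aS * bS ^ 4 * (aS ^ 2 - 16 * bS)) (by ring)

lemma isUnit_bS : IsUnit bS := by
  refine isUnit_of_dvd_unit ?_ isUnit_disc
  exact Dvd.intro (aS ^ 2 * bS ^ 3 * (aS ^ 2 - 16 * bS)) (by ring)

/-- `W(κ) = κ⁴ - (6 / b²) κ² + ((a² - 8 b) / b⁴) κ - 3 / b⁴`. -/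
def polyW : Polynomial S :=
  Polynomial.X ^ 4 - Polynomial.C (6 * Ring.inverse (bS ^ 2)) * Polynomial.X ^ 2 +
    Polynomial.C ((aS ^ 2 - 8 * bS) * Ring.inverse (bS ^ 4)) * Polynomial.X -
    Polynomial.C (3 * Ring.inverse (bS ^ 4))

/-- The ring `S₃ = S[κ] / (W(κ))`. -/
abbrev S3 : Type := AdjoinRoot polyW

def κ : S3 := AdjoinRoot.root polyW

def a : S3 := AdjoinRoot.of polyW aS

def b : S3 := AdjoinRoot.of polyW bS

lemma isUnit_a : IsUnit a := isUnit_aS.map _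

lemma isUnit_b : IsUnit b := isUnit_bS.map _

/-- The coefficients of the target `C'` of the universal isogeny. -/
def a' : S3 :=
  Ring.inverse a * ((a ^ 2 * b ^ 4 - 4 * b ^ 5) * κ ^ 3 + 4 * b ^ 4 * κ ^ 2 +
    (-6 * a ^ 2 * b ^ 2 + 20 * b ^ 3) * κ + a ^ 4 - 12 * a ^ 2 * b + 12 * b ^ 2)

def b' : S3 := b ^ 3

/-- `ψ : C → C'` is the universal isogeny of degree three: its kernel is generated by a point `Q`
of exact order three, it is given by the norm formulas for `Q`, and it pulls `du` back to `κ du`.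
Points of order three are taken on the geometric fibres where `3` is invertible; since `3` is not
a zero divisor, this determines `ψ`. -/
def IsUniversalIsogeny (ψ : PointedMap a b a' b') : Prop :=
  (∀ (K : Type) [Field K] [IsAlgClosed K] [DecidableEq K] (φ : S3 →+* K), (3 : K) ≠ 0 →
    ∃ Q : FibrePoint φ a b, ψ.IsNormMap φ Q) ∧
  ψ.HasCotangentFactor κ

/-- `ψ' : C' → C'/G'`, where `G' = C[3]/G = ψ(C[3])`: it is given by the norm formulas for a
nonzero point `Q' = ψ(T)` of `G'`, with `T` in `C[3]`. The target `C'/G'` has coefficients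
`(a'', b'')`. -/
def IsSecondIsogeny (ψ : PointedMap a b a' b') {a'' b'' : S3}
    (ψ' : PointedMap a' b' a'' b'') : Prop :=
  ∀ (K : Type) [Field K] [IsAlgClosed K] [DecidableEq K] (φ : S3 →+* K), (3 : K) ≠ 0 →
    ∃ (T : FibrePoint φ a b) (Q' : FibrePoint φ a' b'),
      3 • T = 0 ∧ ψ.MapsTo φ T Q' ∧ Q' ≠ 0 ∧ ψ'.IsNormMap φ Q'

end

end FrobIsog

/-!
The theorem is reduced to explicit formulas by means of the parameter of a subgroup of order three.

Let `Q = (X, z)` be a point of order three and define `κ` by `κ (X + b) = -1`. Up to sign and a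
factor, the division polynomial of order three in `X` becomes the quartic
`κ a² = (3 - b κ) (1 + b κ)³`, which is `W(κ) = 0`. With `w = 1 / (1 + b κ)` it takes the form
`κ (b + a² w³) = 3` (`IsogenyParam`), in which it makes sense over any ring. The norm formulas for
`Q` can be written with denominators that are invertible at the identity: `ψ^* u = U / D` and
`ψ^* v = V / D`, with `U`, `V`, `D` polynomials in `u`, `v` over `ℤ[a, b, κ, w]`. The target has
coefficients `(a³ w⁴, b³)`, the scalar is `μ = (1 + b κ)²`, and `U / D = κ u + ⋯`, so that `κ` is
the cotangent factor. The equation of the target (`isoDen_equation`) and the comparison with the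
norm formulas (`iso_norm`) are polynomial identities; together they give the existence of `ψ`
(`exists_represents`, `PointedMap.Represents.isNormMap`). Over `S₃` the coefficient `a³ w⁴` is `a'`
(`exists_universal_param`).

The image `Q'` under `ψ` of a point of order three outside the kernel satisfies
`3 (x(Q') + b³) = b⁴ κ` (`isoNumU_of_three_torsion`). So the parameter of `Q'`, the element `κ'`
with `κ' (x(Q') + b') = -1`, satisfies `b⁴ κ κ' = -3`, that is `κ' = -(b + a² w³) / b⁴`. This is a
parameter for `C'` over `S₃` (`IsogenyParam.dual`), and it gives the second isogeny.

For arbitrary `ψ` and `ψ'` as in the theorem the cotangent factors exist and are unique because the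
cotangent space is free on `du` (`PointedMap.existsUnique_cotangentFactor`). To find their values,
restrict to a geometric fibre. The affine cubic is irreducible, being Eisenstein at `v`
(`prime_uvCubic`), so a morphism given by the norm formulas for `Q` agrees with `U / D` and a
multiple of `V / D`; the equation of the target leaves only the multiple `1`
(`PointedMap.IsNormMap.dvd_v`). Hence its cotangent factor is the parameter of `Q`, its values at
points of order three are the known ones, and `b⁴ κ κ' + 3` vanishes on the fibre. The points of
`S₃` over an algebraic closure of the fraction field of `S` detect zero
(`eq_zero_of_forall_hom`), since `W` is separable there. This proves `b⁴ κ κ' + 3 = 0` in `S₃`; the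
formula for `κ'` follows from `W(κ) = 0`, as `3` is not a zero divisor.
-/

namespace FrobIsog

open MvPolynomial

noncomputable section

/-! ### Germs along the identity section and their expansion to first order -/

section GermRing

variable {R : Type} [CommRing R]

/-- `germ` as a homomorphism of `R`-algebras. -/
def germHom (a b : R) : MvPolynomial (Fin 2) R →ₐ[R] Germ a b :=
  (IsScalarTower.toAlgHom R (Chart a b) (Germ a b)).comp
    (Ideal.Quotient.mkₐ R (Ideal.span {uvEquation a b}))

lemma germHom_apply (a b : R) (F : MvPolynomial (Fin 2) R) : germHom a b F = germ a b F := rfl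

lemma germ_uvEquation (a b : R) : germ a b (uvEquation a b) = 0 := by
  rw [germ, Ideal.Quotient.eq_zero_iff_mem.mpr (Ideal.mem_span_singleton_self _), map_zero]

lemma chartAug_mk (a b : R) (F : MvPolynomial (Fin 2) R) :
    chartAug a b (Ideal.Quotient.mk (Ideal.span {uvEquation a b}) F) = constantCoeff F := by
  have h : chartAug a b (Ideal.Quotient.mk (Ideal.span {uvEquation a b}) F) =
      MvPolynomial.aeval (fun _ => (0 : R)) F := rfl
  rw [h, aeval_zero', Algebra.algebraMap_self_apply]

lemma germAug_germ (a b : R) (F : MvPolynomial (Fin 2) R) :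
    germAug a b (germ a b F) = constantCoeff F := by
  rw [← chartAug_mk a b F]
  exact IsLocalization.lift_eq (M := unitsAtId a b) (S := Germ a b)
      (g := (chartAug a b : Chart a b →+* R)) (fun y => y.2) _

/-- Every germ is a fraction of polynomials with denominator invertible at the identity. -/
lemma exists_germ_fraction {a b : R} (g : Germ a b) :
    ∃ F H : MvPolynomial (Fin 2) R, IsUnit (constantCoeff H) ∧ g * germ a b H = germ a b F := by
  obtain ⟨⟨f, h⟩, hfh⟩ := IsLocalization.surj (unitsAtId a b) g
  obtain ⟨F, rfl⟩ := Ideal.Quotient.mk_surjective f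
  obtain ⟨h, hh⟩ := h
  obtain ⟨H, rfl⟩ := Ideal.Quotient.mk_surjective h
  refine ⟨F, H, ?_, hfh⟩
  rw [← chartAug_mk a b H]
  exact hh

lemma isUnit_germ {a b : R} {F : MvPolynomial (Fin 2) R} (hF : IsUnit (constantCoeff F)) :
    IsUnit (germ a b F) := by
  refine IsLocalization.map_units (M := unitsAtId a b) (Germ a b)
    ⟨Ideal.Quotient.mk _ F, ?_⟩
  rw [← chartAug_mk a b F] at hF
  exact hF

lemma isUnit_of_germAug {a b : R} {g : Germ a b} (hg : IsUnit (germAug a b g)) : IsUnit g := by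
  obtain ⟨F, H, hH, h⟩ := exists_germ_fraction g
  have h2 := congrArg (germAug a b) h
  rw [map_mul, germAug_germ, germAug_germ] at h2
  have h3 : IsUnit (germ a b F) := isUnit_germ (h2 ▸ hg.mul hH)
  exact isUnit_of_mul_isUnit_left (h ▸ h3)

/-- A polynomial whose germ vanishes is, up to a factor invertible at the identity, a multiple
of the equation. -/
lemma exists_dvd_of_germ_eq_zero {a b : R} {G : MvPolynomial (Fin 2) R} (h : germ a b G = 0) :
    ∃ H : MvPolynomial (Fin 2) R, IsUnit (constantCoeff H) ∧ uvEquation a b ∣ H * G := by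
  obtain ⟨⟨c, hc⟩, hcG⟩ := (IsLocalization.map_eq_zero_iff (unitsAtId a b) (Germ a b) _).mp h
  obtain ⟨H, rfl⟩ := Ideal.Quotient.mk_surjective c
  refine ⟨H, ?_, ?_⟩
  · rw [← chartAug_mk a b H]
    exact hc
  · rw [← Ideal.mem_span_singleton, ← Ideal.Quotient.eq_zero_iff_mem, map_mul]
    exact hcG

section Lift

variable {A : Type} [CommRing A] [Algebra R A]

/-- A pair `(p, q)` of elements of an `R`-algebra satisfying the `uv`-equation defines a
homomorphism on germs, once functions invertible at the identity become invertible. -/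
def germLift (a b : R) (p q : A) (h : aeval ![p, q] (uvEquation a b) = 0)
    (hu : ∀ F : MvPolynomial (Fin 2) R, IsUnit (constantCoeff F) → IsUnit (aeval ![p, q] F)) :
    Germ a b →ₐ[R] A :=
  IsLocalization.liftAlgHom (M := unitsAtId a b)
    (f := Ideal.Quotient.liftₐ (Ideal.span {uvEquation a b}) (aeval ![p, q]) (by
      intro f hf
      obtain ⟨g, rfl⟩ := Ideal.mem_span_singleton.mp hf
      rw [map_mul, h, zero_mul]))
    (by
      rintro ⟨c, hc⟩
      obtain ⟨F, rfl⟩ := Ideal.Quotient.mk_surjective c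
      refine hu F ?_
      rw [← chartAug_mk a b F]
      exact hc)

lemma germLift_germ (a b : R) (p q : A) (h hu) (F : MvPolynomial (Fin 2) R) :
    germLift a b p q h hu (germ a b F) = aeval ![p, q] F := by
  exact IsLocalization.lift_eq (M := unitsAtId a b) (S := Germ a b) _ _

end Lift

lemma germ_mul (a b : R) (F G : MvPolynomial (Fin 2) R) :
    germ a b (F * G) = germ a b F * germ a b G := map_mul (germHom a b) F G

lemma germ_C (a b : R) (r : R) : germ a b (C r) = algebraMap R (Germ a b) r :=
  (germHom a b).commutes r

lemma exists_eq_of_constantCoeff_eq_zero {F : MvPolynomial (Fin 2) R}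
    (hF : constantCoeff F = 0) :
    ∃ A B : MvPolynomial (Fin 2) R, F = A * X 0 + B * X 1 := by
  have h : F ∈ Ideal.span (Set.range (X : Fin 2 → MvPolynomial (Fin 2) R)) := by
    rw [← Set.image_univ, mem_ideal_span_X_image]
    intro m hm
    by_contra! hcon
    have : m = 0 := by
      ext i
      exact hcon i (Set.mem_univ i)
    rw [this, mem_support_iff] at hm
    exact hm hF
  have h2 : Set.range (X : Fin 2 → MvPolynomial (Fin 2) R) = {X 0, X 1} := by
    ext
    simp [Fin.exists_fin_two, eq_comm]
  rw [h2, Ideal.mem_span_pair] at h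
  obtain ⟨A, B, h⟩ := h
  exact ⟨A, B, h.symm⟩

/-- The coordinate `v` vanishes to second order at the identity. -/
lemma germ_v_mem_sq (a b : R) : germ a b (X 1) ∈ idIdeal a b ^ 2 := by
  have hu := germ_u_mem a b
  have h := germ_uvEquation a b
  have e : uvEquation a b = X 1 * (1 + C a * X 0 + C (a * b) * X 1 - C b * X 0 ^ 2) - X 0 ^ 3 := by
    rw [uvEquation]
    ring
  rw [e, ← germHom_apply, map_sub, sub_eq_zero, germHom_apply, germ_mul] at h
  obtain ⟨c, hc⟩ : IsUnit (germ a b (1 + C a * X 0 + C (a * b) * X 1 - C b * X 0 ^ 2)) :=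
    isUnit_germ (by simp)
  rw [← hc, ← Units.eq_mul_inv_iff_mul_eq, map_pow, germHom_apply] at h
  rw [h, pow_succ]
  exact Ideal.mul_mem_right _ _ (Ideal.mul_mem_right _ _ (Ideal.pow_mem_pow hu 2))

/-- The cotangent space at the identity is spanned by `du`. -/
lemma exists_smul_du (a b : R) (g : idIdeal a b) :
    ∃ k : R, (idIdeal a b).toCotangent g = k • du a b := by
  obtain ⟨g, hg⟩ := g
  obtain ⟨F, H, hH, h⟩ := exists_germ_fraction g
  have hF : constantCoeff F = 0 := by
    rw [← germAug_germ a b F, ← h, map_mul, RingHom.mem_ker.mp hg, zero_mul]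
  obtain ⟨A, B, rfl⟩ := exists_eq_of_constantCoeff_eq_zero hF
  obtain ⟨c, hc⟩ := isUnit_germ (a := a) (b := b) hH
  rw [← hc, ← Units.eq_mul_inv_iff_mul_eq] at h
  set r := germ a b A * (c⁻¹ : (Germ a b)ˣ) with hr
  refine ⟨germAug a b r, ?_⟩
  have e : germAug a b r • du a b =
      (idIdeal a b).toCotangent (germAug a b r • ⟨germ a b (X 0), germ_u_mem a b⟩) := by
    rw [du, ← LinearMap.map_smul_of_tower]
  rw [e, Ideal.toCotangent_eq]
  have h2 : g - germAug a b r • germ a b (X 0) =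
      (r - algebraMap R (Germ a b) (germAug a b r)) * germ a b (X 0) +
        (germ a b B * (c⁻¹ : (Germ a b)ˣ)) * germ a b (X 1) := by
    rw [h, ← germHom_apply, map_add, map_mul, map_mul, Algebra.smul_def, hr]
    simp only [germHom_apply]
    ring
  change g - germAug a b r • germ a b (X 0) ∈ _
  rw [h2]
  refine Ideal.add_mem _ ?_ (Ideal.mul_mem_left _ _ (germ_v_mem_sq a b))
  rw [pow_two]
  refine Ideal.mul_mem_mul ?_ (germ_u_mem a b)
  rw [idIdeal, RingHom.mem_ker, map_sub, AlgHom.commutes]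
  exact sub_self _

lemma uvEquation_dual (a b : R) :
    aeval ![(DualNumber.eps : DualNumber R), 0] (uvEquation a b) = 0 := by
  simp [uvEquation, pow_succ]

/-- Expansion of germs to first order along the identity: `u ↦ ε`, `v ↦ 0`. -/
def firstOrder (a b : R) : Germ a b →ₐ[R] DualNumber R :=
  germLift a b DualNumber.eps 0 (uvEquation_dual a b) (by
    intro F hF
    rw [TrivSqZeroExt.isUnit_iff_isUnit_fst]
    have h : TrivSqZeroExt.fst (aeval ![(DualNumber.eps : DualNumber R), 0] F) =
        (aeval (R := R) (fun _ => (0 : R)) F) := by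
      have h3 : ((TrivSqZeroExt.fstHom R R R).comp
          (aeval ![(DualNumber.eps : DualNumber R), 0])) = aeval (fun _ => (0 : R)) := by
        ext i
        fin_cases i <;> simp
      exact DFunLike.congr_fun h3 F
    rw [h, aeval_zero', Algebra.algebraMap_self_apply]
    exact hF)

lemma firstOrder_germ (a b : R) (F : MvPolynomial (Fin 2) R) :
    firstOrder a b (germ a b F) = aeval ![(DualNumber.eps : DualNumber R), 0] F :=
  germLift_germ ..

lemma fst_firstOrder (a b : R) (g : Germ a b) :
    TrivSqZeroExt.fst (firstOrder a b g) = germAug a b g := by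
  have h : ((TrivSqZeroExt.fstHom R R R).comp (firstOrder a b)) = germAug a b := by
    refine IsLocalization.algHom_ext (R := R) (unitsAtId a b) ?_
    refine Ideal.Quotient.algHom_ext _ ?_
    ext i
    have h2 := germAug_germ a b (X i)
    have h3 := firstOrder_germ a b (X i)
    simp only [constantCoeff_X] at h2
    change TrivSqZeroExt.fst (firstOrder a b (germ a b (X i))) = germAug a b (germ a b (X i))
    rw [h2, h3]
    fin_cases i <;> simp
  exact DFunLike.congr_fun h g

lemma firstOrder_eq_of_toCotangent {a b : R} (g : idIdeal a b) (k : R)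
    (h : (idIdeal a b).toCotangent g = k • du a b) :
    firstOrder a b g = TrivSqZeroExt.inr k := by
  have e : k • du a b =
      (idIdeal a b).toCotangent (k • ⟨germ a b (X 0), germ_u_mem a b⟩) := by
    rw [du, ← LinearMap.map_smul_of_tower]
  rw [e, Ideal.toCotangent_eq] at h
  have h2 : idIdeal a b ^ 2 ≤ RingHom.ker (firstOrder a b) := by
    rw [pow_two, Ideal.mul_le]
    intro r hr s hs
    rw [RingHom.mem_ker, map_mul]
    have h1 : TrivSqZeroExt.fst (firstOrder a b r) = 0 := (fst_firstOrder a b r).trans hr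
    have h2 : TrivSqZeroExt.fst (firstOrder a b s) = 0 := (fst_firstOrder a b s).trans hs
    ext <;> simp [h1, h2]
  have h3 := RingHom.mem_ker.mp (h2 h)
  rw [map_sub, sub_eq_zero] at h3
  rw [h3]
  change firstOrder a b (k • germ a b (X 0)) = _
  rw [map_smul, firstOrder_germ, aeval_X, Matrix.cons_val_zero, DualNumber.eps,
    ← TrivSqZeroExt.inr_smul, smul_eq_mul, mul_one]

variable {a b a₂ b₂ : R}

lemma PointedMap.pullback_u_mem (ψ : PointedMap a b a₂ b₂) :
    ψ.pullback (germ a₂ b₂ (X 0)) ∈ idIdeal a b :=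
  Ideal.mem_comap.mp (ψ.le_comap (germ_u_mem a₂ b₂))

lemma PointedMap.cotangentMap_du (ψ : PointedMap a b a₂ b₂) :
    ψ.cotangentMap (du a₂ b₂) = (idIdeal a b).toCotangent
      ⟨ψ.pullback (germ a₂ b₂ (X 0)), ψ.pullback_u_mem⟩ := rfl

lemma PointedMap.hasCotangentFactor_iff_toCotangent (ψ : PointedMap a b a₂ b₂) (k : R) :
    ψ.HasCotangentFactor k ↔ (idIdeal a b).toCotangent
      ⟨ψ.pullback (germ a₂ b₂ (X 0)), ψ.pullback_u_mem⟩ = k • du a b := by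
  rw [PointedMap.HasCotangentFactor, PointedMap.cotangentMap_du]

lemma PointedMap.HasCotangentFactor.firstOrder_eq {ψ : PointedMap a b a₂ b₂} {k : R}
    (h : ψ.HasCotangentFactor k) :
    firstOrder a b (ψ.pullback (germ a₂ b₂ (X 0))) = TrivSqZeroExt.inr k := by
  rw [PointedMap.hasCotangentFactor_iff_toCotangent] at h
  exact firstOrder_eq_of_toCotangent _ k h

/-- Every morphism has exactly one cotangent factor, the cotangent space being free on `du`. -/
lemma PointedMap.existsUnique_cotangentFactor (ψ : PointedMap a b a₂ b₂) :
    ∃! k : R, ψ.HasCotangentFactor k := by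
  obtain ⟨k, hk⟩ := exists_smul_du a b
    ⟨ψ.pullback (germ a₂ b₂ (X 0)), ψ.pullback_u_mem⟩
  rw [← PointedMap.hasCotangentFactor_iff_toCotangent] at hk
  refine ⟨k, hk, fun l hl => ?_⟩
  have h := hl.firstOrder_eq.symm.trans hk.firstOrder_eq
  exact TrivSqZeroExt.inr_injective h

/-- The cotangent factor can be read off from the expansion of `ψ^* u` to first order. -/
lemma PointedMap.hasCotangentFactor_iff (ψ : PointedMap a b a₂ b₂) (k : R) :
    ψ.HasCotangentFactor k ↔
      firstOrder a b (ψ.pullback (germ a₂ b₂ (X 0))) = TrivSqZeroExt.inr k := by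
  refine ⟨fun h => h.firstOrder_eq, fun h => ?_⟩
  obtain ⟨l, hl, -⟩ := ψ.existsUnique_cotangentFactor
  have h2 := h.symm.trans hl.firstOrder_eq
  rwa [TrivSqZeroExt.inr_injective h2]

end GermRing

/-! ### The isogeny of degree three attached to a parameter -/

section Formulas

variable {A : Type} [CommRing A]

/-- The conditions under which the formulas below define an isogeny of degree three with source
the curve with coefficients `(a, b)` and cotangent factor `κ`. Here `w` is the inverse of
`1 + b κ`; when `b` is invertible, the second condition is the quartic equation of `κ`. -/
structure IsogenyParam (a b κ w : A) : Prop where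
  unit : (1 + b * κ) * w = 1
  rel : κ * (b + a ^ 2 * w ^ 3) = 3

lemma IsogenyParam.map {B : Type} [CommRing B] {a b κ w : A} (h : IsogenyParam a b κ w)
    (f : A →+* B) : IsogenyParam (f a) (f b) (f κ) (f w) := by
  constructor
  · simpa using congrArg f h.unit
  · simpa only [map_mul, map_add, map_pow, map_ofNat] using congrArg f h.rel

/-- The linear form `κ u + (1 + b κ) v`; its zeros are the identity and the points of order three
in the kernel of the isogeny. -/
def kernelForm (b κ u v : A) : A := κ * u + (1 + b * κ) * v

/-- The numerator of `ψ^* u`, divided by `kernelForm`. In terms of `x` and `y` it is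
`x (x² + s x + s b) / y²` with `s = b (1 + b κ) (3 - b κ)`. -/
def isoNumU (a b κ u v : A) : A :=
  1 + a * u + a * b * v - b * u ^ 2 + b * (1 + b * κ) * (3 - b * κ) * u * (u + b * v)

/-- The common denominator of `ψ^* u` and `ψ^* v`. It is the product of `y(P)`, `y(P - Q)` and
`y(P + Q)`, up to a unit and powers of `kernelForm` and of `v`. -/
def isoDen (a b κ w u v : A) : A :=
  1 + a * u + a * b * v - b * u ^ 2 + b * (1 + b * κ) * u ^ 2 +
    a ^ 2 * w ^ 2 * (u + b * (1 + b * κ) * v) * (u + b * v) +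
    a * (b * κ - 1) * w * (1 + a * u + a * b * v) * (u + b * (1 + b * κ) * v)

/-- Negation on the curve, applied to `isoDen`, gives a conjugate denominator; the product of
the two is a polynomial in `x`. -/
lemma isoDen_mul_conj {a b j r n s u v : A}
    (hc : u ^ 3 + b * u ^ 2 * v - v * (1 + a * u + a * b * v) = 0)
    (h1 : 2 * r + a * n - n ^ 2 - 2 * s = 0) (h2 : r ^ 2 + a * n * r - s ^ 2 = 0) :
    (1 + a * u + a * b * v - b * u ^ 2 + b * j * u ^ 2 + r * (u + b * j * v) * (u + b * v) +
        n * (1 + a * u + a * b * v) * (u + b * j * v)) *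
      (1 + a * u + a * b * v - b * u ^ 2 + b * j * u ^ 2 + r * (u + b * j * v) * (u + b * v) +
        (a - n) * (1 + a * u + a * b * v) * (u + b * j * v) +
        a * r * (u + b * j * v) * (u + b * v) ^ 2) =
    (1 + a * u + a * b * v - b * u ^ 2 + s * u * (u + b * v)) ^ 2 *
      (1 + a * u + a * b * v - b * u ^ 2 + b * (2 * j + 1) * u ^ 2 +
        b ^ 2 * (2 * j + j ^ 2) * u * v + b ^ 3 * j ^ 2 * v ^ 2) := by
  linear_combination
    (-2*u^3*b^3*j + 4*u^3*b^2*j*s - 2*u^3*b*j*s^2 - u^2*v*b^4*j^2 + 2*u^2*v*b^3*j^2*s +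
    4*u^2*v*b^3*j*s - u^2*v*b^2*j^2*s^2 - 4*u^2*v*b^2*j*s^2 + u^2*a^2*r*n + 4*u^2*a*b^2*j -
    u^2*a*b^2 + u^2*a*b*j*r - 4*u^2*a*b*j*s - u^2*a*b*r + 2*u^2*a*b*s + u^2*a*r^2 - u^2*a*s^2 +
    2*u*v^2*b^4*j^2*s - 2*u*v^2*b^3*j^2*s^2 - 2*u*v^2*b^3*j*s^2 + 2*u*v*a^2*b*j*r*n +
    2*u*v*a^2*b*r*n + 2*u*v*a*b^3*j^2 + 2*u*v*a*b^3*j + u*v*a*b^2*j^2*r - 2*u*v*a*b^2*j^2*s -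
    4*u*v*a*b^2*j*s - u*v*a*b^2*r + 2*u*v*a*b^2*s + 2*u*v*a*b*j*r^2 - 2*u*v*a*b*j*s^2 +
    2*u*v*a*b*r^2 - 2*u*v*a*b*s^2 + u*a^3*n - u*a^2*b*j + u*a^2*b + 2*u*a^2*r - u*a^2*n^2 -
    2*u*a^2*s + u*a*r*n + u*b^2*j^2 + 2*u*b^2*j + 2*u*b*j*r - 4*u*b*j*s - 2*u*b*r + 2*u*b*s +
    u*r^2 - u*s^2 - v^3*b^4*j^2*s^2 + v^2*a^2*b^2*j^2*r*n + 4*v^2*a^2*b^2*j*r*n + v^2*a^2*b^2*r*n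
    + v^2*a*b^4*j^2 + v^2*a*b^3*j^2*r - 2*v^2*a*b^3*j^2*s - v^2*a*b^3*j*r + v^2*a*b^2*j^2*r^2 -
    v^2*a*b^2*j^2*s^2 + 4*v^2*a*b^2*j*r^2 - 4*v^2*a*b^2*j*s^2 + v^2*a*b^2*r^2 - v^2*a*b^2*s^2 +
    2*v*a^3*b*j*n + v*a^3*b*n + v*a^3*r*n - v*a^2*b^2*j + v*a^2*b^2 + 4*v*a^2*b*j*r -
    2*v*a^2*b*j*n^2 - 4*v*a^2*b*j*s + 2*v*a^2*b*r - v*a^2*b*n^2 - 2*v*a^2*b*s + v*a^2*r^2 -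
    v*a^2*s^2 + 2*v*a*b*j*r*n + v*a*b*r*n + v*b^3*j^2 + 2*v*b^2*j^2*r - 2*v*b^2*j^2*s -
    2*v*b^2*j*r + 2*v*b*j*r^2 - 2*v*b*j*s^2 + v*b*r^2 - v*b*s^2 + 2*a^2*n - a*b*j + a*b + 4*a*r -
    2*a*n^2 - 4*a*s)*hc + (2*u^2*v^3*a*b^3*j^2 + 2*u^2*v^3*a*b^3*j + 2*u^2*v^2*a^2*b*j +
    2*u^2*v^2*a^2*b + u^2*v^2*b^2*j^2 + 2*u^2*v^2*b^2*j + 2*u^2*v*a + 3*u*v^4*a*b^4*j^2 +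
    2*u*v^4*a*b^4*j + u*v^3*a^2*b^2*j^2 + 6*u*v^3*a^2*b^2*j + 3*u*v^3*a^2*b^2 + 2*u*v^3*b^3*j^2 +
    2*u*v^3*b^3*j + u*v^2*a^3 + 4*u*v^2*a*b*j + 4*u*v^2*a*b + u*v + v^5*a*b^5*j^2 +
    v^4*a^2*b^3*j^2 + 4*v^4*a^2*b^3*j + v^4*a^2*b^3 + v^4*b^4*j^2 + v^3*a^3*b + v^3*a*b^2*j^2 +
    6*v^3*a*b^2*j + 2*v^3*a*b^2 + v^2*a^2 + 2*v^2*b*j + v^2*b)*h2 + (u^2*v^2*a^2*b^2*j^2 +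
    2*u^2*v^2*a^2*b^2*j + u^2*v*a^3 + 4*u^2*v*a*b*j + u^2 + 2*u*v^3*a^2*b^3*j^2 +
    2*u*v^3*a^2*b^3*j + 2*u*v^2*a^3*b*j + 2*u*v^2*a^3*b + 2*u*v^2*a*b^2*j^2 + 4*u*v^2*a*b^2*j +
    3*u*v*a^2 + 2*u*v*b*j + v^4*a^2*b^4*j^2 + 2*v^3*a^3*b^2*j + v^3*a^3*b^2 + 2*v^3*a*b^3*j^2 +
    2*v^2*a^2*b*j + 3*v^2*a^2*b + v^2*b^2*j^2 + 2*v*a)*h1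

lemma isoDen_conj {a b κ j r n a' u v : A}
    (hc : u ^ 3 + b * u ^ 2 * v - v * (1 + a * u + a * b * v) = 0)
    (hk : κ * b - j + 1 = 0) (h3 : a' * κ - a + 2 * n = 0) (h4 : a * r - a' * j ^ 2 = 0)
    (h5 : a * b - 2 * b * n - a' * (j - 1) = 0) :
    (1 + a * u + a * b * v - b * u ^ 2 + b * j * u ^ 2 + r * (u + b * j * v) * (u + b * v) +
        n * (1 + a * u + a * b * v) * (u + b * j * v)) +
      a' * (κ * u + j * v) * (1 + a * u + a * b * v - b * u ^ 2 + b * (2 * j + 1) * u ^ 2 +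
        b ^ 2 * (2 * j + j ^ 2) * u * v + b ^ 3 * j ^ 2 * v ^ 2) =
    1 + a * u + a * b * v - b * u ^ 2 + b * j * u ^ 2 + r * (u + b * j * v) * (u + b * v) +
      (a - n) * (1 + a * u + a * b * v) * (u + b * j * v) +
      a * r * (u + b * j * v) * (u + b * v) ^ 2 := by
  linear_combination
    (-a*r + 2*b*j*κ*a')*hc + (u^2*v*b*j^2*a' + u*v^2*b^2*j^2*a' + 2*u*v*a*j*a' + u*v*a*a' +
    2*v^2*a*b*j*a' + 2*v*j*a')*hk + (-u^2*v*b*j - u^2*v*b - 2*u*v^2*b^2*j - u*v^2*b^2 - u*v*a -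
    v^3*b^3*j - v^2*a*b - v)*h4 + (u^2*a + u)*h3 + (-u*v*a*j - u*v*a - v^2*a*b*j - v*j)*h5

/-- The equation of the target, divided by the cube of `kernelForm`: with `x'` and `y'` the
coordinates on the target, it is `y' (y' + a' (x' + b')) = x'² (x' + b')`, and the left-hand side
is a denominator times its conjugate. -/
lemma isoDen_equation {a b κ w u v : A} (h : IsogenyParam a b κ w)
    (hc : v + a * u * v + a * b * v ^ 2 = u ^ 3 + b * u ^ 2 * v) :
    isoDen a b κ w u v * (isoDen a b κ w u v + a ^ 3 * w ^ 4 * kernelForm b κ u v *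
        (isoNumU a b κ u v + b ^ 3 * kernelForm b κ u v ^ 2)) =
      isoNumU a b κ u v ^ 2 * (isoNumU a b κ u v + b ^ 3 * kernelForm b κ u v ^ 2) := by
  obtain ⟨hw, hr⟩ := h
  obtain ⟨j, hj⟩ : ∃ j, j = 1 + b * κ := ⟨_, rfl⟩
  rw [← hj] at hw
  have hk : κ * b - j + 1 = 0 := by linear_combination -hj
  have hκ : κ * a ^ 2 * w ^ 3 = 4 - j := by linear_combination hr + hj
  have hc' : u ^ 3 + b * u ^ 2 * v - v * (1 + a * u + a * b * v) = 0 := by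
    linear_combination -hc
  have e1 : isoDen a b κ w u v = 1 + a * u + a * b * v - b * u ^ 2 + b * j * u ^ 2 +
      (a ^ 2 * w ^ 2) * (u + b * j * v) * (u + b * v) +
      (a * (j - 2) * w) * (1 + a * u + a * b * v) * (u + b * j * v) := by
    rw [isoDen, ← hj]
    linear_combination -(a * w * (1 + a * u + a * b * v) * (u + b * j * v)) * hj
  have e2 : isoNumU a b κ u v =
      1 + a * u + a * b * v - b * u ^ 2 + (b * j * (4 - j)) * u * (u + b * v) := by
    rw [isoNumU, ← hj]
    linear_combination (b * j * u * (u + b * v)) * hj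
  have e3 : kernelForm b κ u v = κ * u + j * v := by rw [kernelForm, hj]
  have e4 : isoNumU a b κ u v + b ^ 3 * kernelForm b κ u v ^ 2 =
      1 + a * u + a * b * v - b * u ^ 2 + b * (2 * j + 1) * u ^ 2 +
        b ^ 2 * (2 * j + j ^ 2) * u * v + b ^ 3 * j ^ 2 * v ^ 2 := by
    rw [e2, e3]
    linear_combination (u ^ 2 * b ^ 2 * κ + u ^ 2 * b * j - u ^ 2 * b + 2 * u * v * b ^ 2 * j) * hk
  rw [e4, e1, e2, e3, isoDen_conj (a' := a ^ 3 * w ^ 4) hc' hk, isoDen_mul_conj hc']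
  · linear_combination -(a ^ 2 * (j - 2) * w + 2 * a ^ 2 * w ^ 2 * κ * b) * hw -
      2 * a ^ 2 * w ^ 2 * hk + 2 * b * j * hκ
  · linear_combination
      -(a ^ 4 * w ^ 3 * (j - 2) + a ^ 4 * w ^ 4 * κ ^ 2 * b ^ 2 * (j * w + 1)) * hw -
      a ^ 4 * w ^ 4 * (κ * b + j - 1) * hk + b ^ 2 * j ^ 2 * (κ * a ^ 2 * w ^ 3 + 4 - j) * hκ
  · linear_combination a * w * hκ + a * hw
  · linear_combination -a ^ 3 * w ^ 2 * (j * w + 1) * hw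
  · linear_combination -a * b * hw + a ^ 3 * w ^ 4 * hk - a * b * w * hκ

/-- The images `u' = U / D` and `v' = V / D` satisfy the equation of the target, cleared of
denominators. -/
lemma iso_uvEquation {a b κ w u v : A} (h : IsogenyParam a b κ w)
    (hc : v + a * u * v + a * b * v ^ 2 = u ^ 3 + b * u ^ 2 * v) :
    kernelForm b κ u v ^ 3 * isoDen a b κ w u v ^ 2 +
      a ^ 3 * w ^ 4 * (kernelForm b κ u v * isoNumU a b κ u v) * kernelForm b κ u v ^ 3 *
        isoDen a b κ w u v +
      a ^ 3 * w ^ 4 * b ^ 3 * (kernelForm b κ u v ^ 3) ^ 2 * isoDen a b κ w u v =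
    (kernelForm b κ u v * isoNumU a b κ u v) ^ 3 +
      b ^ 3 * (kernelForm b κ u v * isoNumU a b κ u v) ^ 2 * kernelForm b κ u v ^ 3 := by
  linear_combination kernelForm b κ u v ^ 3 * isoDen_equation h hc

variable {B : Type} [CommRing B] (f : A →+* B) (a b κ w u v : A)

lemma map_kernelForm : f (kernelForm b κ u v) = kernelForm (f b) (f κ) (f u) (f v) := by
  simp [kernelForm]

lemma map_isoNumU : f (isoNumU a b κ u v) = isoNumU (f a) (f b) (f κ) (f u) (f v) := by
  simp only [isoNumU, map_add, map_sub, map_mul, map_pow, map_one, map_ofNat]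

lemma map_isoDen : f (isoDen a b κ w u v) = isoDen (f a) (f b) (f κ) (f w) (f u) (f v) := by
  simp [isoDen]

end Formulas

section Isogeny

variable {R : Type} [CommRing R]

/-- The polynomial `U` with `ψ^* u = U / D`. -/
def isoU (a b κ : R) : MvPolynomial (Fin 2) R :=
  kernelForm (C b) (C κ) (X 0) (X 1) * isoNumU (C a) (C b) (C κ) (X 0) (X 1)

/-- The polynomial `V` with `ψ^* v = V / D`. -/
def isoV (b κ : R) : MvPolynomial (Fin 2) R := kernelForm (C b) (C κ) (X 0) (X 1) ^ 3

/-- The common denominator `D` of `ψ^* u` and `ψ^* v`, as a polynomial in `u` and `v`. -/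
def isoD (a b κ w : R) : MvPolynomial (Fin 2) R :=
  isoDen (C a) (C b) (C κ) (C w) (X 0) (X 1)

section Eval

variable {A : Type} [CommRing A] (f : MvPolynomial (Fin 2) R →+* A) (a b κ w : R)

lemma map_isoU : f (isoU a b κ) = kernelForm (f (C b)) (f (C κ)) (f (X 0)) (f (X 1)) *
    isoNumU (f (C a)) (f (C b)) (f (C κ)) (f (X 0)) (f (X 1)) := by
  rw [isoU, map_mul, map_kernelForm, map_isoNumU]

lemma map_isoV : f (isoV b κ) = kernelForm (f (C b)) (f (C κ)) (f (X 0)) (f (X 1)) ^ 3 := by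
  rw [isoV, map_pow, map_kernelForm]

lemma map_isoD : f (isoD a b κ w) =
    isoDen (f (C a)) (f (C b)) (f (C κ)) (f (C w)) (f (X 0)) (f (X 1)) := by
  rw [isoD, map_isoDen]

end Eval

variable {a b κ w : R}

lemma constantCoeff_isoD : constantCoeff (isoD a b κ w) = 1 := by
  rw [map_isoD]
  simp [isoDen]

lemma isUnit_germ_isoD : IsUnit (germ a b (isoD a b κ w)) :=
  isUnit_germ (by rw [constantCoeff_isoD]; exact isUnit_one)

/-- The germ `1 / D`. -/
def invD (a b κ w : R) : Germ a b :=
  ((isUnit_germ_isoD (a := a) (b := b) (κ := κ) (w := w)).unit⁻¹ : (Germ a b)ˣ)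

lemma germ_isoD_mul_invD : germ a b (isoD a b κ w) * invD a b κ w = 1 :=
  (isUnit_germ_isoD (a := a) (b := b) (κ := κ) (w := w)).mul_val_inv

lemma germAug_isoU : germAug a b (germ a b (isoU a b κ)) = 0 := by
  rw [germAug_germ, map_isoU]
  simp [kernelForm]

lemma germAug_isoV : germAug a b (germ a b (isoV b κ)) = 0 := by
  rw [germAug_germ, map_isoV]
  simp [kernelForm]

lemma aeval_iso_uvEquation (h : IsogenyParam a b κ w) :
    aeval ![germ a b (isoU a b κ) * invD a b κ w, germ a b (isoV b κ) * invD a b κ w]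
      (uvEquation (a ^ 3 * w ^ 4) (b ^ 3)) = 0 := by
  have hd := germ_isoD_mul_invD (a := a) (b := b) (κ := κ) (w := w)
  have hc := germ_uvEquation a b
  rw [← germHom_apply] at hc
  simp only [← germHom_apply] at hd ⊢
  have h2 := iso_uvEquation (u := germHom a b (X 0)) (v := germHom a b (X 1))
    (h.map ((germHom a b : MvPolynomial (Fin 2) R →+* Germ a b).comp C))
    (by
      rw [uvEquation] at hc
      simp only [map_sub, map_add, map_mul, map_pow] at hc
      simp only [RingHom.comp_apply, RingHom.coe_coe]
      linear_combination hc)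
  have hU := map_isoU (germHom a b : MvPolynomial (Fin 2) R →+* Germ a b) a b κ
  have hV := map_isoV (germHom a b : MvPolynomial (Fin 2) R →+* Germ a b) b κ
  have hD := map_isoD (germHom a b : MvPolynomial (Fin 2) R →+* Germ a b) a b κ w
  simp only [RingHom.comp_apply, RingHom.coe_coe] at h2 hU hV hD
  rw [← hV, ← hU, ← hD] at h2
  have hC : ∀ r : R, algebraMap R (Germ a b) r = germHom a b (C r) := fun r => (germ_C a b r).symm
  rw [uvEquation]
  simp only [map_sub, map_add, map_mul, map_pow, aeval_X, aeval_C, Matrix.cons_val_zero,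
    Matrix.cons_val_one, hC]
  generalize germHom a b (isoU a b κ) = U at *
  generalize germHom a b (isoV b κ) = V at *
  generalize germHom a b (isoD a b κ w) = D at *
  generalize invD a b κ w = d at *
  linear_combination d ^ 3 * h2 + (-V * d * (D * d + 1) -
    germHom a b (C a) ^ 3 * germHom a b (C w) ^ 4 * (U * V * d ^ 2 +
      germHom a b (C b) ^ 3 * V ^ 2 * d ^ 2)) * hd

lemma isUnit_aeval_iso {F : MvPolynomial (Fin 2) R} (hF : IsUnit (constantCoeff F)) :
    IsUnit (aeval ![germ a b (isoU a b κ) * invD a b κ w,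
      germ a b (isoV b κ) * invD a b κ w] F) := by
  refine isUnit_of_germAug ?_
  have e : germAug a b (aeval ![germ a b (isoU a b κ) * invD a b κ w,
      germ a b (isoV b κ) * invD a b κ w] F) = constantCoeff F := by
    have h3 : (germAug a b).comp (aeval ![germ a b (isoU a b κ) * invD a b κ w,
      germ a b (isoV b κ) * invD a b κ w]) = aeval (fun _ => (0 : R)) := by
      ext i
      fin_cases i <;> simp [germAug_isoU, germAug_isoV]
    have h4 := DFunLike.congr_fun h3 F
    rw [aeval_zero', Algebra.algebraMap_self_apply] at h4
    exact h4
  rw [e]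
  exact hF

/-- The pull-back of germs along the isogeny with parameters `(a, b, κ, w)`. -/
def isoPullback (h : IsogenyParam a b κ w) : Germ (a ^ 3 * w ^ 4) (b ^ 3) →ₐ[R] Germ a b :=
  germLift _ _ (germ a b (isoU a b κ) * invD a b κ w) (germ a b (isoV b κ) * invD a b κ w)
    (aeval_iso_uvEquation h) (fun _ hF => isUnit_aeval_iso hF)

lemma isoPullback_germ (h : IsogenyParam a b κ w) (F : MvPolynomial (Fin 2) R) :
    isoPullback h (germ _ _ F) = aeval ![germ a b (isoU a b κ) * invD a b κ w,
      germ a b (isoV b κ) * invD a b κ w] F :=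
  germLift_germ _ _ _ _ (aeval_iso_uvEquation h) (fun _ hF => isUnit_aeval_iso hF) F

/-- The isogeny of degree three with parameters `(a, b, κ, w)`, as a map on germs. -/
def isoMap (h : IsogenyParam a b κ w) : PointedMap a b (a ^ 3 * w ^ 4) (b ^ 3) where
  pullback := isoPullback h
  map_id := by
    refine IsLocalization.algHom_ext (R := R) (unitsAtId (a ^ 3 * w ^ 4) (b ^ 3)) ?_
    refine Ideal.Quotient.algHom_ext _ ?_
    ext i
    have h2 := germAug_germ (a ^ 3 * w ^ 4) (b ^ 3) (X i)
    have h3 := isoPullback_germ h (X i)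
    rw [constantCoeff_X] at h2
    change germAug a b (isoPullback h (germ (a ^ 3 * w ^ 4) (b ^ 3) (X i))) =
      germAug (a ^ 3 * w ^ 4) (b ^ 3) (germ (a ^ 3 * w ^ 4) (b ^ 3) (X i))
    rw [h2, h3, aeval_X]
    fin_cases i <;> simp [germAug_isoU, germAug_isoV]

lemma isoMap_pullback_u (h : IsogenyParam a b κ w) :
    (isoMap h).pullback (germ _ _ (X 0)) * germ a b (isoD a b κ w) = germ a b (isoU a b κ) := by
  have e : (isoMap h).pullback (germ _ _ (X 0)) = germ a b (isoU a b κ) * invD a b κ w := by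
    refine (isoPullback_germ h _).trans ?_
    rw [aeval_X, Matrix.cons_val_zero]
  rw [e, mul_assoc, mul_comm (invD a b κ w), germ_isoD_mul_invD, mul_one]

lemma isoMap_pullback_v (h : IsogenyParam a b κ w) :
    (isoMap h).pullback (germ _ _ (X 1)) * germ a b (isoD a b κ w) = germ a b (isoV b κ) := by
  have e : (isoMap h).pullback (germ _ _ (X 1)) = germ a b (isoV b κ) * invD a b κ w := by
    refine (isoPullback_germ h _).trans ?_
    rw [aeval_X, Matrix.cons_val_one, Matrix.cons_val_zero]
  rw [e, mul_assoc, mul_comm (invD a b κ w), germ_isoD_mul_invD, mul_one]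

/-- To first order along the identity, `U = κ u`. -/
lemma aeval_eps_isoU (a b κ : R) :
    aeval ![(DualNumber.eps : DualNumber R), 0] (isoU a b κ) = TrivSqZeroExt.inr κ := by
  have h := map_isoU (aeval ![(DualNumber.eps : DualNumber R), 0] :
    MvPolynomial (Fin 2) R →ₐ[R] DualNumber R).toRingHom a b κ
  refine h.trans ?_
  ext <;> simp [kernelForm, isoNumU, TrivSqZeroExt.algebraMap_eq_inl]

lemma fst_aeval_eps (F : MvPolynomial (Fin 2) R) :
    TrivSqZeroExt.fst (aeval ![(DualNumber.eps : DualNumber R), 0] F) = constantCoeff F := by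
  rw [← firstOrder_germ 0 0, fst_firstOrder, germAug_germ]

lemma isoMap_hasCotangentFactor (h : IsogenyParam a b κ w) :
    (isoMap h).HasCotangentFactor κ := by
  rw [PointedMap.hasCotangentFactor_iff]
  have h2 := congrArg (firstOrder a b) (isoMap_pullback_u h)
  rw [map_mul, firstOrder_germ, firstOrder_germ, aeval_eps_isoU] at h2
  have hD : TrivSqZeroExt.fst (aeval ![(DualNumber.eps : DualNumber R), 0] (isoD a b κ w)) = 1 := by
    rw [fst_aeval_eps, constantCoeff_isoD]
  generalize firstOrder a b ((isoMap h).pullback (germ _ _ (X 0))) = p at *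
  have h3 := congrArg TrivSqZeroExt.fst h2
  have h4 := congrArg TrivSqZeroExt.snd h2
  simp [hD] at h3 h4
  ext
  · simpa using h3
  · simpa [h3] using h4

end Isogeny

/-! ### The affine cubic over a field -/

section Bivariate

variable {K : Type} [Field K]

/-- The `uv`-equation over a field as a monic cubic polynomial in `u` over `K[v]`. -/
def uvCubic (a b : K) : Polynomial (Polynomial K) :=
  Polynomial.X ^ 3 + Polynomial.C (Polynomial.C b * Polynomial.X) * Polynomial.X ^ 2 -
    Polynomial.C (Polynomial.C a * Polynomial.X) * Polynomial.X -
    Polynomial.C (Polynomial.X + Polynomial.C (a * b) * Polynomial.X ^ 2)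

lemma uvCubic_eq_cubic (a b : K) : uvCubic a b =
    Cubic.toPoly ⟨1, Polynomial.C b * Polynomial.X, -(Polynomial.C a * Polynomial.X),
      -(Polynomial.X + Polynomial.C (a * b) * Polynomial.X ^ 2)⟩ := by
  rw [uvCubic, Cubic.toPoly]
  simp only [map_neg, map_one]
  ring

lemma natDegree_uvCubic (a b : K) : (uvCubic a b).natDegree = 3 := by
  rw [uvCubic_eq_cubic]
  exact Cubic.natDegree_of_a_ne_zero one_ne_zero

lemma monic_uvCubic (a b : K) : (uvCubic a b).Monic := by
  rw [uvCubic_eq_cubic]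
  exact Cubic.monic_of_a_eq_one rfl

/-- The `uv`-equation is an Eisenstein polynomial at `v`. -/
lemma prime_uvCubic (a b : K) : Prime (uvCubic a b) := by
  rw [← irreducible_iff_prime]
  have hdeg := natDegree_uvCubic a b
  have hmonic := monic_uvCubic a b
  have hprime : (Ideal.span {(Polynomial.X : Polynomial K)}).IsPrime :=
    (Ideal.span_singleton_prime Polynomial.X_ne_zero).mpr Polynomial.prime_X
  refine Polynomial.irreducible_of_eisenstein_criterion hprime ?_ ?_ ?_ ?_ hmonic.isPrimitive
  · rw [hmonic.leadingCoeff]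
    exact fun h => hprime.ne_top ((Ideal.eq_top_iff_one _).mpr h)
  · intro n hn
    rw [Polynomial.degree_eq_natDegree hmonic.ne_zero, hdeg, Nat.cast_lt] at hn
    rw [Ideal.mem_span_singleton]
    interval_cases n
    · rw [uvCubic_eq_cubic, Cubic.coeff_eq_d]
      exact ⟨-(1 + Polynomial.C (a * b) * Polynomial.X), by ring⟩
    · rw [uvCubic_eq_cubic, Cubic.coeff_eq_c]
      exact ⟨-Polynomial.C a, by ring⟩
    · rw [uvCubic_eq_cubic, Cubic.coeff_eq_b]
      exact ⟨Polynomial.C b, by ring⟩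
  · rw [Polynomial.degree_eq_natDegree hmonic.ne_zero, hdeg]
    norm_num
  · rw [uvCubic_eq_cubic, Cubic.coeff_eq_d, Ideal.span_singleton_pow, Ideal.mem_span_singleton]
    rintro ⟨g, hg⟩
    have h1 : (Polynomial.X : Polynomial K) =
        Polynomial.X ^ 2 * (-g - Polynomial.C (a * b)) := by
      linear_combination -hg
    have h2 := congrArg (fun p => Polynomial.coeff p 1) h1
    simp [Polynomial.coeff_X_pow_mul', -map_mul] at h2

/-- A polynomial over `R` in `u` and `v`, specialised to the fibre at `φ` and viewed as a
polynomial in `u` over `K[v]`. -/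
def toBiv {R : Type} [CommRing R] (φ : R →+* K) :
    MvPolynomial (Fin 2) R →+* Polynomial (Polynomial K) :=
  eval₂Hom (Polynomial.C.comp (Polynomial.C.comp φ)) ![Polynomial.X, Polynomial.C Polynomial.X]

section ToBiv

variable {R : Type} [CommRing R] (φ : R →+* K)

lemma toBiv_C (r : R) : toBiv φ (C r) = Polynomial.C (Polynomial.C (φ r)) := by simp [toBiv]

lemma toBiv_X_zero : toBiv φ (X 0) = Polynomial.X := by simp [toBiv]

lemma toBiv_X_one : toBiv φ (X 1) = Polynomial.C Polynomial.X := by simp [toBiv]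

lemma toBiv_uvEquation (a b : R) : toBiv φ (uvEquation a b) = -uvCubic (φ a) (φ b) := by
  simp only [uvEquation, uvCubic, map_sub, map_add, map_mul, map_pow, toBiv_C, toBiv_X_zero,
    toBiv_X_one]
  ring

lemma evalEval_toBiv (u v : K) (F : MvPolynomial (Fin 2) R) :
    (toBiv φ F).evalEval v u = eval₂ φ ![u, v] F := by
  have h : (Polynomial.evalEvalRingHom v u).comp (toBiv φ) = eval₂Hom φ ![u, v] := by
    ext i
    · simp [toBiv]
    · fin_cases i <;> simp [toBiv]
  exact DFunLike.congr_fun h F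

lemma evalEval_uvCubic (a b u v : K) : (uvCubic a b).evalEval v u =
    u ^ 3 + b * u ^ 2 * v - (v + a * u * v + a * b * v ^ 2) := by
  simp [uvCubic, Polynomial.evalEval]
  ring

lemma evalEval_zero_toBiv (F : MvPolynomial (Fin 2) R) :
    (toBiv φ F).evalEval 0 0 = φ (constantCoeff F) := by
  rw [evalEval_toBiv]
  have h : (![0, 0] : Fin 2 → K) = 0 := by ext i; fin_cases i <;> rfl
  rw [h]
  exact eval₂_zero_apply φ F

lemma uvCubic_not_dvd_of_isUnit {a b : K} {H : MvPolynomial (Fin 2) R}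
    (hH : IsUnit (constantCoeff H)) : ¬ uvCubic a b ∣ toBiv φ H := by
  rintro ⟨G, hG⟩
  have h := congrArg (Polynomial.evalEval 0 0) hG
  rw [evalEval_zero_toBiv, Polynomial.evalEval_mul, evalEval_uvCubic] at h
  refine (hH.map φ).ne_zero (h.trans ?_)
  simp

lemma dvd_toBiv_of_germ_eq_zero {a b : R} {G : MvPolynomial (Fin 2) R} (h : germ a b G = 0) :
    uvCubic (φ a) (φ b) ∣ toBiv φ G := by
  obtain ⟨H, hH, hd⟩ := exists_dvd_of_germ_eq_zero h
  have h2 := map_dvd (toBiv φ) hd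
  rw [toBiv_uvEquation, map_mul] at h2
  have h3 : uvCubic (φ a) (φ b) ∣ -uvCubic (φ a) (φ b) := ⟨-1, by ring⟩
  exact ((prime_uvCubic _ _).dvd_or_dvd (h3.trans h2)).resolve_left (uvCubic_not_dvd_of_isUnit φ hH)

/-- Two representations of the same germ agree on the curve. -/
lemma eval₂_mul_eq_of_germ {a b : R} {g : Germ a b} {F H N D : MvPolynomial (Fin 2) R}
    (h1 : g * germ a b H = germ a b F) (h2 : g * germ a b D = germ a b N) {u v : K}
    (hc : v + φ a * u * v + φ a * φ b * v ^ 2 = u ^ 3 + φ b * u ^ 2 * v) :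
    eval₂ φ ![u, v] F * eval₂ φ ![u, v] D = eval₂ φ ![u, v] N * eval₂ φ ![u, v] H := by
  have h : germ a b (F * D - N * H) = 0 := by
    rw [← germHom_apply, map_sub, map_mul, map_mul]
    simp only [germHom_apply]
    rw [← h1, ← h2]
    ring
  obtain ⟨G, hG⟩ := dvd_toBiv_of_germ_eq_zero φ h
  have h3 := congrArg (Polynomial.evalEval v u) hG
  rw [evalEval_toBiv, Polynomial.evalEval_mul, evalEval_uvCubic, ← hc, sub_self, zero_mul,
    eval₂_sub, eval₂_mul, eval₂_mul] at h3
  exact sub_eq_zero.mp h3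

end ToBiv

/-- A polynomial vanishing at all points of the affine cubic is divisible by its equation. -/
lemma uvCubic_dvd_of_forall [IsAlgClosed K] {a b : K} {G : Polynomial (Polynomial K)}
    (h : ∀ u v : K, v + a * u * v + a * b * v ^ 2 = u ^ 3 + b * u ^ 2 * v →
      G.evalEval v u = 0) : uvCubic a b ∣ G := by
  by_contra hG
  have hmonic := monic_uvCubic a b
  have : IsDomain (AdjoinRoot (uvCubic a b)) :=
    AdjoinRoot.isDomain_of_prime (prime_uvCubic a b)
  have hint : Algebra.IsIntegral (Polynomial K) (AdjoinRoot (uvCubic a b)) :=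
    have := hmonic.finite_adjoinRoot
    inferInstance
  have hne : AdjoinRoot.mk (uvCubic a b) G ≠ 0 := by rwa [Ne, AdjoinRoot.mk_eq_zero]
  -- a nonzero multiple of `G` modulo the equation lies in `K[v]`
  obtain ⟨r, hr, hrG⟩ : ∃ r : Polynomial K, r ≠ 0 ∧
      algebraMap (Polynomial K) (AdjoinRoot (uvCubic a b)) r ∈
        Ideal.span {AdjoinRoot.mk (uvCubic a b) G} := by
    have := Ideal.comap_ne_bot_of_integral_mem (R := Polynomial K) hne
      (Ideal.mem_span_singleton_self (AdjoinRoot.mk (uvCubic a b) G)) (hint.isIntegral _)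
    obtain ⟨r, hr, hr0⟩ := Submodule.exists_mem_ne_zero_of_ne_bot this
    exact ⟨r, hr0, hr⟩
  obtain ⟨g, hg⟩ := Ideal.mem_span_singleton.mp hrG
  obtain ⟨A, rfl⟩ := AdjoinRoot.mk_surjective g
  rw [AdjoinRoot.algebraMap_eq, ← AdjoinRoot.mk_C, ← map_mul, AdjoinRoot.mk_eq_mk] at hg
  obtain ⟨B, hB⟩ := hg
  obtain ⟨v, hv⟩ : ∃ v : K, r.eval v ≠ 0 := by
    by_contra! hcon
    exact hr (Polynomial.funext (by simpa using hcon))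
  obtain ⟨u, hu⟩ : ∃ u : K, (uvCubic a b).evalEval v u = 0 := by
    have hm2 := hmonic.map (Polynomial.evalRingHom v)
    have hd : ((uvCubic a b).map (Polynomial.evalRingHom v)).degree ≠ 0 := by
      rw [hmonic.degree_map, uvCubic_eq_cubic, Cubic.degree_of_a_ne_zero one_ne_zero]
      norm_num
    obtain ⟨u, hu⟩ := IsAlgClosed.exists_root _ hd
    refine ⟨u, ?_⟩
    rw [← Polynomial.map_evalRingHom_eval]
    exact hu
  have h3 := congrArg (Polynomial.evalEval v u) hB
  rw [Polynomial.evalEval_sub, Polynomial.evalEval_mul, Polynomial.evalEval_mul, hu, zero_mul,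
    h u v (by rw [evalEval_uvCubic] at hu; linear_combination -hu), zero_mul, sub_zero] at h3
  refine hv ?_
  simpa [Polynomial.evalEval] using h3

end Bivariate

/-! ### Points of order three -/

section Points

open WeierstrassCurve.Affine

variable {K : Type} [Field K] {a b κ w : K}

lemma curve_equation_iff {x y : K} : (curve a b).toAffine.Equation x y ↔
    y ^ 2 + a * x * y + a * b * y = x ^ 3 + b * x ^ 2 := by
  rw [WeierstrassCurve.Affine.equation_iff]
  simp [curve]

lemma curve_Δ : (curve a b).Δ = a ^ 2 * b ^ 4 * (a ^ 2 - 16 * b) := by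
  simp only [curve, WeierstrassCurve.Δ, WeierstrassCurve.b₂, WeierstrassCurve.b₄,
    WeierstrassCurve.b₆, WeierstrassCurve.b₈]
  ring

/-- The conditions for the curve with coefficients `(a, b)` to be an elliptic curve over a field
in which `2` and `3` are invertible. -/
structure GoodFibre (a b : K) : Prop where
  two : (2 : K) ≠ 0
  three : (3 : K) ≠ 0
  ha : a ≠ 0
  hb : b ≠ 0
  disc : a ^ 2 - 16 * b ≠ 0

lemma GoodFibre.nonsingular (h : GoodFibre a b) {x y : K}
    (he : y ^ 2 + a * x * y + a * b * y = x ^ 3 + b * x ^ 2) :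
    (curve a b).toAffine.Nonsingular x y := by
  rw [← WeierstrassCurve.Affine.equation_iff_nonsingular_of_Δ_ne_zero, curve_equation_iff]
  · exact he
  · rw [curve_Δ]
    exact mul_ne_zero (mul_ne_zero (pow_ne_zero _ h.ha) (pow_ne_zero _ h.hb)) h.disc

lemma IsogenyParam.j_ne_zero (hp : IsogenyParam a b κ w) : 1 + b * κ ≠ 0 := by
  intro h
  have := hp.unit
  rw [h, zero_mul] at this
  exact zero_ne_one this

lemma IsogenyParam.w_ne_zero (hp : IsogenyParam a b κ w) : w ≠ 0 := by
  rintro rfl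
  have := hp.unit
  rw [mul_zero] at this
  exact zero_ne_one this

lemma IsogenyParam.κ_ne_zero (hp : IsogenyParam a b κ w) (h : GoodFibre a b) : κ ≠ 0 := by
  rintro rfl
  have := hp.rel
  rw [zero_mul] at this
  exact h.three this.symm

/-- The quartic equation of `κ`. -/
lemma IsogenyParam.mul_sq (hp : IsogenyParam a b κ w) :
    κ * a ^ 2 = (3 - b * κ) * (1 + b * κ) ^ 3 := by
  linear_combination (1 + b * κ) ^ 3 * hp.rel - κ * a ^ 2 *
    ((1 + b * κ) ^ 2 * w ^ 2 + (1 + b * κ) * w + 1) * hp.unit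

lemma IsogenyParam.bκ_ne_one (hp : IsogenyParam a b κ w) (h : GoodFibre a b) : b * κ - 1 ≠ 0 := by
  intro hk
  have h1 := hp.mul_sq
  have hk' : b * κ = 1 := by linear_combination hk
  have h2 : a ^ 2 = 16 * b := by linear_combination b * h1 + (-a ^ 2 +
    b * (-(1 + b * κ) ^ 3 + 2 * (b ^ 2 * κ ^ 2 + 4 * b * κ + 7))) * hk'
  exact h.disc (by rw [h2, sub_self])

lemma IsogenyParam.bκ_ne_three (hp : IsogenyParam a b κ w) (h : GoodFibre a b) : 3 - b * κ ≠ 0 := by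
  intro hk
  have h1 := hp.mul_sq
  rw [hk, zero_mul] at h1
  exact mul_ne_zero (hp.κ_ne_zero h) (pow_ne_zero 2 h.ha) h1

/-- The square of `2 y + a x + a b` at a point in the kernel. -/
lemma kernel_psi_sq (hp : IsogenyParam a b κ w) {X z : K} (hX : κ * (X + b) = -1)
    (hz : z ^ 2 + a * X * z + a * b * z = X ^ 3 + b * X ^ 2) :
    κ ^ 3 * (2 * z + a * X + a * b) ^ 2 = -((1 + b * κ) * (b * κ - 1)) ^ 2 := by
  have hX' : κ * X = -(1 + b * κ) := by linear_combination hX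
  have e1 : κ ^ 3 * (2 * z + a * X + a * b) ^ 2 =
      κ * (X + b) * (4 * (κ * X) ^ 2 + κ * a ^ 2 * (κ * (X + b))) := by
    linear_combination 4 * κ ^ 3 * hz
  rw [e1, hX, hX', hp.mul_sq]
  ring

lemma kernel_psi_ne_zero (h : GoodFibre a b) (hp : IsogenyParam a b κ w) {X z : K}
    (hX : κ * (X + b) = -1) (hz : z ^ 2 + a * X * z + a * b * z = X ^ 3 + b * X ^ 2) :
    2 * z + a * X + a * b ≠ 0 := by
  intro h0
  have h1 := kernel_psi_sq hp hX hz
  rw [h0] at h1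
  refine pow_ne_zero 2 (mul_ne_zero hp.j_ne_zero (hp.bκ_ne_one h)) ?_
  linear_combination h1

/-- The doubling formula in terms of the division polynomial of order three. -/
lemma doubling_identity {X z l : K}
    (hz : z ^ 2 + a * X * z + a * b * z = X ^ 3 + b * X ^ 2)
    (hl : l * (2 * z + a * X + a * b) = 3 * X ^ 2 + 2 * b * X - a * z) :
    (l ^ 2 + a * l - b - X - X - X) * (2 * z + a * X + a * b) ^ 2 =
      -(3 * X ^ 4 + (a ^ 2 + 4 * b) * X ^ 3 + 3 * a ^ 2 * b * X ^ 2 + 3 * a ^ 2 * b ^ 2 * X +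
        a ^ 2 * b ^ 3) := by
  linear_combination (l * (2 * z + a * X + a * b) + (3 * X ^ 2 + 2 * b * X - a * z) +
    a * (2 * z + a * X + a * b)) * hl - (a ^ 2 + 4 * b + 12 * X) * hz

/-- The product of the `x`-coordinates of `P + Q` and `P - Q`, where `P = (x, y)`, `Q = (X, z)` and
`l`, `m` are the slopes of the chords through `P` and `Q`, and through `P` and `-Q`. -/
lemma addX_mul_addX {x y X z : K} (hx : x ≠ X)
    (hP : y ^ 2 + a * x * y + a * b * y = x ^ 3 + b * x ^ 2)
    (hQ : z ^ 2 + a * X * z + a * b * z = X ^ 3 + b * X ^ 2) {l m : K}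
    (hl : l * (x - X) = y - z) (hm : m * (x - X) = y - (-z - a * X - a * b)) :
    (l ^ 2 + a * l - b - x - X) * (m ^ 2 + a * m - b - x - X) * (x - X) ^ 2 =
    x ^ 2 * X ^ 2 - x * X * a ^ 2 * b - (x + X) * a ^ 2 * b ^ 2 - a ^ 2 * b ^ 3 := by
  have hd : x - X ≠ 0 := sub_ne_zero.mpr hx
  have e1 : (l ^ 2 + a * l - b - x - X) * (x - X) ^ 2 =
      (y - z) ^ 2 + a * (y - z) * (x - X) - (b + x + X) * (x - X) ^ 2 := by
    rw [← hl]
    ring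
  have e2 : (m ^ 2 + a * m - b - x - X) * (x - X) ^ 2 =
      (y - (-z - a * X - a * b)) ^ 2 + a * (y - (-z - a * X - a * b)) * (x - X) -
        (b + x + X) * (x - X) ^ 2 := by
    rw [← hm]
    ring
  refine mul_right_cancel₀ (pow_ne_zero 2 hd) ?_
  refine (show _ = ((l ^ 2 + a * l - b - x - X) * (x - X) ^ 2) *
    ((m ^ 2 + a * m - b - x - X) * (x - X) ^ 2) by ring).trans ?_
  rw [e1, e2]
  linear_combination
    (y^2 + y*x*a + y*a*b - 2*z^2 - 2*z*X*a - 2*z*a*b - x^3 + 2*x^2*X - x^2*b + 2*x*X^2 + x*X*a^2 +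
    4*x*X*b + x*a^2*b - 2*X^3 - X^2*a^2 - 2*X^2*b - X*a^2*b)*hP + (z^2 + z*X*a + z*a*b - 4*x^3 +
    2*x^2*X - x^2*a^2 - 4*x^2*b + 2*x*X^2 + x*X*a^2 + 4*x*X*b - x*a^2*b - X^3 - X^2*b +
    X*a^2*b)*hQ

/-- The product of the `y`-coordinates of `P + Q` and `P - Q`, in the same notation. -/
lemma addY_mul_addY {x y X z : K} (hx : x ≠ X)
    (hP : y ^ 2 + a * x * y + a * b * y = x ^ 3 + b * x ^ 2)
    (hQ : z ^ 2 + a * X * z + a * b * z = X ^ 3 + b * X ^ 2) {l m : K}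
    (hl : l * (x - X) = y - z) (hm : m * (x - X) = y - (-z - a * X - a * b)) :
    (-(l * ((l ^ 2 + a * l - b - x - X) - x) + y) - a * (l ^ 2 + a * l - b - x - X) - a * b) *
      (-(m * ((m ^ 2 + a * m - b - x - X) - x) + y) - a * (m ^ 2 + a * m - b - x - X) - a * b) *
        (x - X) ^ 3 =
      X * (X + 2 * b) * (x * (X + b) + b * X) * a * y - x ^ 3 * X ^ 2 * (X + b) -
        x ^ 2 * (X ^ 3 * b + X * a ^ 2 * b ^ 2 + a ^ 2 * b ^ 3) -
        x * a ^ 2 * b ^ 3 * (2 * X + b) - X * a ^ 2 * b ^ 4 := by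
  have hd : x - X ≠ 0 := sub_ne_zero.mpr hx
  have e1 : (-(l * ((l ^ 2 + a * l - b - x - X) - x) + y) - a * (l ^ 2 + a * l - b - x - X) -
      a * b) * (x - X) ^ 3 =
      -((y - z) * ((y - z) ^ 2 + a * (y - z) * (x - X) - (b + x + X) * (x - X) ^ 2 -
        x * (x - X) ^ 2) + y * (x - X) ^ 3) -
        a * ((y - z) ^ 2 + a * (y - z) * (x - X) - (b + x + X) * (x - X) ^ 2) * (x - X) -
        a * b * (x - X) ^ 3 := by
    rw [← hl]
    ring
  have e2 : (-(m * ((m ^ 2 + a * m - b - x - X) - x) + y) - a * (m ^ 2 + a * m - b - x - X) -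
      a * b) * (x - X) ^ 3 =
      -((y - (-z - a * X - a * b)) * ((y - (-z - a * X - a * b)) ^ 2 +
        a * (y - (-z - a * X - a * b)) * (x - X) - (b + x + X) * (x - X) ^ 2 -
        x * (x - X) ^ 2) + y * (x - X) ^ 3) -
        a * ((y - (-z - a * X - a * b)) ^ 2 + a * (y - (-z - a * X - a * b)) * (x - X) -
          (b + x + X) * (x - X) ^ 2) * (x - X) - a * b * (x - X) ^ 3 := by
    rw [← hm]
    ring
  refine mul_right_cancel₀ (pow_ne_zero 3 hd) ?_
  refine (show _ = ((-(l * ((l ^ 2 + a * l - b - x - X) - x) + y) -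
      a * (l ^ 2 + a * l - b - x - X) - a * b) * (x - X) ^ 3) *
    ((-(m * ((m ^ 2 + a * m - b - x - X) - x) + y) - a * (m ^ 2 + a * m - b - x - X) - a * b) *
      (x - X) ^ 3) by ring).trans ?_
  rw [e1, e2]
  linear_combination
    (y^4 + 3*y^3*x*a - y^3*X*a + 2*y^3*a*b - 3*y^2*z^2 - 3*y^2*z*X*a - 3*y^2*z*a*b - y^2*x^3 +
    3*y^2*x^2*a^2 - y^2*x^2*b + 6*y^2*x*X^2 - y^2*x*X*a^2 + 4*y^2*x*X*b + 5*y^2*x*a^2*b -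
    4*y^2*X^3 - y^2*X^2*a^2 - 2*y^2*X^2*b - 3*y^2*X*a^2*b + y^2*a^2*b^2 - 5*y*z^2*x*a +
    2*y*z^2*X*a - 3*y*z^2*a*b - 5*y*z*x*X*a^2 - 5*y*z*x*a^2*b + 2*y*z*X^2*a^2 - y*z*X*a^2*b -
    3*y*z*a^2*b^2 - 2*y*x^4*a + 2*y*x^3*X*a + y*x^3*a^3 - 2*y*x^3*a*b + 9*y*x^2*X^2*a +
    y*x^2*X*a^3 + 6*y*x^2*X*a*b + 4*y*x^2*a^3*b - y*x^2*a*b^2 - 11*y*x*X^3*a - 3*y*x*X^2*a^3 +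
    y*x*X^2*a*b - 4*y*x*X*a^3*b + 4*y*x*X*a*b^2 + 2*y*x*a^3*b^2 + 3*y*X^4*a + y*X^3*a^3 -
    3*y*X^3*a*b - 2*y*X^2*a*b^2 - 2*y*X*a^3*b^2 + 3*z^4 + 6*z^3*X*a + 6*z^3*a*b + 3*z^2*x^3 -
    18*z^2*x^2*X - 3*z^2*x^2*a^2 - 3*z^2*x^2*b + 18*z^2*x*X^2 + 2*z^2*x*X*a^2 - 4*z^2*x*a^2*b -
    6*z^2*X^3 + 4*z^2*X^2*a^2 + 10*z^2*X*a^2*b + 3*z^2*a^2*b^2 + 3*z*x^3*X*a + 3*z*x^3*a*b -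
    18*z*x^2*X^2*a - 3*z*x^2*X*a^3 - 21*z*x^2*X*a*b - 3*z*x^2*a^3*b - 3*z*x^2*a*b^2 + 18*z*x*X^3*a
    + 2*z*x*X^2*a^3 + 18*z*x*X^2*a*b - 2*z*x*X*a^3*b - 4*z*x*a^3*b^2 - 6*z*X^4*a + z*X^3*a^3 -
    6*z*X^3*a*b + 5*z*X^2*a^3*b + 4*z*X*a^3*b^2 - x^5*a^2 + 2*x^4*X*a^2 - x^4*a^2*b +
    3*x^3*X^2*a^2 + x^3*X*a^4 + 4*x^3*X*a^2*b + x^3*a^4*b + 9*x^2*X^4 - 7*x^2*X^3*a^2 +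
    12*x^2*X^3*b - 2*x^2*X^2*a^4 - 2*x^2*X^2*a^2*b + 4*x^2*X^2*b^2 - x^2*X*a^4*b - x^2*X*a^2*b^2 +
    x^2*a^4*b^2 - x^2*a^2*b^3 - 12*x*X^5 + 4*x*X^4*a^2 - 14*x*X^4*b + x*X^3*a^4 - 4*x*X^3*b^2 -
    x*X^2*a^4*b + 4*x*X^2*a^2*b^2 - 2*x*X*a^4*b^2 + 2*x*X*a^2*b^3 + 4*X^6 - X^5*a^2 + 4*X^5*b -
    X^4*a^2*b + X^4*b^2 + X^3*a^4*b - 3*X^3*a^2*b^2 + X^2*a^4*b^2 - X^2*a^2*b^3)*hP + (y*z^2*x*a -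
    y*z^2*X*a + y*z*x*X*a^2 + y*z*x*a^2*b - y*z*X^2*a^2 - y*z*X*a^2*b - 2*y*x^4*a - y*x^3*X*a -
    y*x^3*a^3 - y*x^3*a*b + 9*y*x^2*X^2*a + 2*y*x^2*X*a^3 - y*x^2*X*a*b - y*x^2*a^3*b -
    8*y*x*X^3*a - y*x*X^2*a^3 + 4*y*x*X^2*a*b + 2*y*x*X*a^3*b + 2*y*X^4*a - 2*y*X^3*a*b -
    y*X^2*a^3*b - z^4 - 2*z^3*X*a - 2*z^3*a*b + 7*z^2*x^3 - 6*z^2*x^2*X + 2*z^2*x^2*a^2 +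
    5*z^2*x^2*b - 2*z^2*x*X*a^2 - 4*z^2*x*X*b + 2*z^2*x*a^2*b + z^2*X^3 - z^2*X^2*a^2 + z^2*X^2*b
    - 4*z^2*X*a^2*b - z^2*a^2*b^2 + 7*z*x^3*X*a + 7*z*x^3*a*b - 6*z*x^2*X^2*a + 2*z*x^2*X*a^3 -
    z*x^2*X*a*b + 2*z*x^2*a^3*b + 5*z*x^2*a*b^2 - 2*z*x*X^2*a^3 - 4*z*x*X^2*a*b - 4*z*x*X*a*b^2 +
    2*z*x*a^3*b^2 + z*X^4*a + 2*z*X^3*a*b - 2*z*X^2*a^3*b + z*X^2*a*b^2 - 2*z*X*a^3*b^2 - x^6 -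
    6*x^5*X - 3*x^5*a^2 - 4*x^5*b + 9*x^4*X^2 + x^4*X*a^2 - 4*x^4*X*b - x^4*a^4 - 4*x^4*a^2*b -
    4*x^4*b^2 - 3*x^3*X^3 + 7*x^3*X^2*a^2 + 9*x^3*X^2*b + 2*x^3*X*a^4 + 4*x^3*X*b^2 - 2*x^3*a^4*b
    - 7*x^2*X^3*a^2 - 3*x^2*X^3*b - x^2*X^2*a^4 + 10*x^2*X^2*a^2*b - x^2*X^2*b^2 + 4*x^2*X*a^4*b -
    3*x^2*X*a^2*b^2 - x^2*a^4*b^2 + x^2*a^2*b^3 + 2*x*X^4*a^2 - 8*x*X^3*a^2*b - 2*x*X^2*a^4*b +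
    4*x*X^2*a^2*b^2 + 2*x*X*a^4*b^2 - 2*x*X*a^2*b^3 + 2*X^4*a^2*b - X^3*a^2*b^2 - X^2*a^4*b^2 +
    X^2*a^2*b^3)*hQ

variable [DecidableEq K]

/-- Points with `κ (x + b) = -1` have order three. -/
lemma three_nsmul_eq_zero (h : GoodFibre a b) (hp : IsogenyParam a b κ w) {X z : K}
    (hX : κ * (X + b) = -1) (hn : (curve a b).toAffine.Nonsingular X z) :
    3 • (Point.some X z hn) = 0 := by
  have hz := curve_equation_iff.mp hn.1
  have hψ := kernel_psi_ne_zero h hp hX hz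
  have hy : z ≠ (curve a b).toAffine.negY X z := by
    intro hy
    simp only [WeierstrassCurve.Affine.negY, curve] at hy
    exact hψ (by linear_combination hy)
  have hκ := hp.κ_ne_zero h
  have hx : (curve a b).toAffine.addX X X ((curve a b).toAffine.slope X X z z) = X := by
    rw [slope_of_Y_ne rfl hy]
    simp only [WeierstrassCurve.Affine.negY, WeierstrassCurve.Affine.addX, curve]
    have e : z - (-z - a * X - a * b) = 2 * z + a * X + a * b := by ring
    rw [e]
    have hX' : X = -b - 1 / κ := by field_simp; linear_combination hX
    have hq : 3 * X ^ 4 + (a ^ 2 + 4 * b) * X ^ 3 + 3 * a ^ 2 * b * X ^ 2 + 3 * a ^ 2 * b ^ 2 * X +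
        a ^ 2 * b ^ 3 = 0 := by
      rw [hX']
      field_simp
      linear_combination -hp.mul_sq
    have hl := doubling_identity (l := (3 * X ^ 2 + 2 * b * X + 0 - a * z) /
      (2 * z + a * X + a * b)) hz (by rw [div_mul_cancel₀ _ hψ, add_zero])
    rw [hq, neg_zero, mul_eq_zero, or_iff_left (pow_ne_zero 2 hψ), sub_eq_zero] at hl
    exact hl
  have h2 : Point.some X z hn + Point.some X z hn =
      Point.some _ _ (nonsingular_add hn hn fun hxy => hy hxy.right) := Point.add_self_of_Y_ne hy
  rcases (Point.X_eq_iff (h₁ := nonsingular_add hn hn fun hxy => hy hxy.right) (h₂ := hn)).mp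
    hx with h3 | h3
  · exfalso
    rw [← h2, add_eq_left] at h3
    exact Point.some_ne_zero hn h3
  · rw [succ_nsmul, two_nsmul, h2, h3, neg_add_cancel]

/-- Every point of order three is of the form `κ (x + b) = -1` for a parameter `κ`, because the
division polynomial of order three turns into the quartic equation under this substitution. -/
lemma exists_param_of_three_nsmul (h : GoodFibre a b) {Q : (curve a b).toAffine.Point}
    (hQ : Q ≠ 0) (h3 : 3 • Q = 0) :
    ∃ X z hn κ w, Q = Point.some X z hn ∧ IsogenyParam a b κ w ∧ κ * (X + b) = -1 := by
  rcases Q with _ | ⟨X, z, hn⟩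
  · exact absurd rfl hQ
  have hz := curve_equation_iff.mp hn.1
  have hneg : Point.some X z hn + Point.some X z hn = -Point.some X z hn := by
    rw [eq_neg_iff_add_eq_zero, ← two_nsmul, ← succ_nsmul]
    exact h3
  have hy : z ≠ (curve a b).toAffine.negY X z := by
    intro hy
    rw [Point.add_self_of_Y_eq hy, eq_comm, neg_eq_zero] at hneg
    exact hQ hneg
  have hψ : 2 * z + a * X + a * b ≠ 0 := by
    intro h0
    refine hy ?_
    simp only [WeierstrassCurve.Affine.negY, curve]
    linear_combination h0
  rw [Point.add_self_of_Y_ne hy, Point.neg_some, Point.some.injEq] at hneg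
  have hx := hneg.1
  rw [slope_of_Y_ne rfl hy] at hx
  simp only [WeierstrassCurve.Affine.negY, WeierstrassCurve.Affine.addX, curve] at hx
  have e : z - (-z - a * X - a * b) = 2 * z + a * X + a * b := by ring
  rw [e] at hx
  have hq : 3 * X ^ 4 + (a ^ 2 + 4 * b) * X ^ 3 + 3 * a ^ 2 * b * X ^ 2 + 3 * a ^ 2 * b ^ 2 * X +
      a ^ 2 * b ^ 3 = 0 := by
    have hl := doubling_identity (l := (3 * X ^ 2 + 2 * b * X + 0 - a * z) /
      (2 * z + a * X + a * b)) hz (by rw [div_mul_cancel₀ _ hψ, add_zero])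
    rw [hx, sub_self, zero_mul, eq_comm, neg_eq_zero] at hl
    exact hl
  have hX0 : X ≠ 0 := by
    rintro rfl
    refine mul_ne_zero (pow_ne_zero 2 h.ha) (pow_ne_zero 3 h.hb) ?_
    linear_combination hq
  have hXb : X + b ≠ 0 := by
    intro hXb
    have hXb' : X = -b := by linear_combination hXb
    rw [hXb'] at hq
    exact pow_ne_zero 4 h.hb (by linear_combination -hq)
  refine ⟨X, z, hn, -1 / (X + b), (X + b) / X, rfl, ⟨?_, ?_⟩, ?_⟩
  · field_simp
    ring
  · field_simp
    linear_combination -hq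
  · field_simp

end Points

/-! ### The isogeny in terms of points -/

section PointFormulas

open WeierstrassCurve.Affine

variable {K : Type} [Field K] {a b κ w : K}

lemma HasUV.equation {P : (curve a b).toAffine.Point} {u v : K} (h : HasUV P u v) :
    v + a * u * v + a * b * v ^ 2 = u ^ 3 + b * u ^ 2 * v := by
  rcases P with _ | ⟨x, y, hn⟩
  · obtain ⟨rfl, rfl⟩ := h
    ring
  · obtain ⟨hv, rfl⟩ := h
    have hP := curve_equation_iff.mp hn.1
    linear_combination v ^ 3 * hP - (v + a * x * v ^ 2 + a * b * v ^ 2 + v ^ 2 * y) * hv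

lemma kernelForm_eq (x v : K) : kernelForm b κ (x * v) v = (κ * (x + b) + 1) * v := by
  rw [kernelForm]
  ring

lemma isoNumU_mul_sq {x y v : K} (hv : v * y = 1)
    (hP : y ^ 2 + a * x * y + a * b * y = x ^ 3 + b * x ^ 2) :
    isoNumU a b κ (x * v) v * y ^ 2 =
      x * (x ^ 2 + b * (1 + b * κ) * (3 - b * κ) * (x + b)) := by
  have hy : y ≠ 0 := right_ne_zero_of_mul_eq_one hv
  obtain rfl : v = 1 / y := by field_simp; linear_combination hv
  rw [isoNumU]
  field_simp
  linear_combination hP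

lemma isoDen_mul_cube {x y v : K} (hv : v * y = 1)
    (hP : y ^ 2 + a * x * y + a * b * y = x ^ 3 + b * x ^ 2) :
    isoDen a b κ w (x * v) v * y ^ 3 = (x + b * (1 + b * κ)) *
      ((x ^ 2 + a ^ 2 * w ^ 2 * (x + b)) * y + a * (b * κ - 1) * w * (x ^ 2 * (x + b))) := by
  have hy : y ≠ 0 := right_ne_zero_of_mul_eq_one hv
  obtain rfl : v = 1 / y := by field_simp; linear_combination hv
  rw [isoDen]
  field_simp
  linear_combination (y + a * (b * κ - 1) * w * (x + b * (1 + b * κ))) * hP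

/-- `x(P + Q) x(P - Q)` in terms of the parameter `κ` of `Q`. -/
lemma kernel_addX_mul_addX (hp : IsogenyParam a b κ w) {x X : K} (hX : κ * (X + b) = -1) :
    κ ^ 2 * (x ^ 2 * X ^ 2 - x * X * a ^ 2 * b - (x + X) * a ^ 2 * b ^ 2 - a ^ 2 * b ^ 3) =
      (1 + b * κ) ^ 2 * (x ^ 2 + b * (1 + b * κ) * (3 - b * κ) * (x + b)) := by
  have hX' : κ * X = -(1 + b * κ) := by linear_combination hX
  have e : κ ^ 2 * (x ^ 2 * X ^ 2 - x * X * a ^ 2 * b - (x + X) * a ^ 2 * b ^ 2 - a ^ 2 * b ^ 3) =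
      x ^ 2 * (κ * X) ^ 2 - (κ * a ^ 2) * b * (x + b) * (κ * X + κ * b) := by ring
  rw [e, hX', hp.mul_sq]
  ring

/-- `y(P) y(P + Q) y(P - Q)` in terms of the parameter `κ` of `Q`. -/
lemma kernel_addY_mul_addY (hp : IsogenyParam a b κ w) {x y X : K} (hX : κ * (X + b) = -1)
    (hP : y ^ 2 + a * x * y + a * b * y = x ^ 3 + b * x ^ 2) :
    κ ^ 3 * (y * (X * (X + 2 * b) * (x * (X + b) + b * X) * a * y - x ^ 3 * X ^ 2 * (X + b) -
        x ^ 2 * (X ^ 3 * b + X * a ^ 2 * b ^ 2 + a ^ 2 * b ^ 3) -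
        x * a ^ 2 * b ^ 3 * (2 * X + b) - X * a ^ 2 * b ^ 4)) =
      (1 + b * κ) ^ 2 * ((x + b * (1 + b * κ)) *
        ((x ^ 2 + a ^ 2 * w ^ 2 * (x + b)) * y + a * (b * κ - 1) * w * (x ^ 2 * (x + b)))) := by
  have hX' : κ * X = -(1 + b * κ) := by linear_combination hX
  have e : κ ^ 3 * (y * (X * (X + 2 * b) * (x * (X + b) + b * X) * a * y -
        x ^ 3 * X ^ 2 * (X + b) -
        x ^ 2 * (X ^ 3 * b + X * a ^ 2 * b ^ 2 + a ^ 2 * b ^ 3) -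
        x * a ^ 2 * b ^ 3 * (2 * X + b) - X * a ^ 2 * b ^ 4)) =
      y * ((κ * X) * (κ * X + 2 * (κ * b)) * (x * (κ * X + κ * b) + b * (κ * X)) * a * y -
        x ^ 3 * (κ * X) ^ 2 * (κ * X + κ * b) -
        x ^ 2 * ((κ * X) ^ 3 * b + (κ * X) * a ^ 2 * (κ * b) ^ 2 + a ^ 2 * (κ * b) ^ 3) -
        x * a ^ 2 * b * (κ * b) ^ 2 * (2 * (κ * X) + κ * b) -
          (κ * X) * a ^ 2 * b ^ 2 * (κ * b) ^ 2) := by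
    ring
  rw [e, hX']
  have hw := hp.unit
  obtain ⟨j, hj⟩ : ∃ j, j = 1 + b * κ := ⟨_, rfl⟩
  have hk : κ * b = j - 1 := by linear_combination -hj
  have hk' : b * κ = j - 1 := by linear_combination -hj
  rw [← hj] at hw ⊢
  rw [hk, hk']
  linear_combination (a * j * (j - 2) * (x + b * j)) * hP -
    (x + b * j) * (a ^ 2 * (x + b) * y * (j * w + 1) + j * a * (j - 2) * x ^ 2 * (x + b)) * hw

lemma exists_of_hasUV_some {x y u v : K} {hn : (curve a b).toAffine.Nonsingular x y}
    (h : HasUV (Point.some x y hn) u v) : v * y = 1 ∧ u = x * v := h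

lemma hasUV_zero {u v : K} (h : HasUV (0 : (curve a b).toAffine.Point) u v) : u = 0 ∧ v = 0 := h

/-- The denominator does not vanish on the kernel. -/
lemma isoDen_ne_zero_of_kernel (h : GoodFibre a b) (hp : IsogenyParam a b κ w) {X z v : K}
    (hX : κ * (X + b) = -1) (hv : v * z = 1)
    (hQ : z ^ 2 + a * X * z + a * b * z = X ^ 3 + b * X ^ 2) :
    isoDen a b κ w (X * v) v ≠ 0 := by
  have hX' : κ * X = -(1 + b * κ) := by linear_combination hX
  have hc : v + a * (X * v) * v + a * b * v ^ 2 = (X * v) ^ 3 + b * (X * v) ^ 2 * v := by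
    linear_combination v ^ 3 * hQ - (v + a * X * v ^ 2 + a * b * v ^ 2 + v ^ 2 * z) * hv
  have h1 := isoDen_equation hp hc
  have h2 := isoNumU_mul_sq (κ := κ) hv hQ
  rw [kernelForm_eq, hX] at h1
  intro h0
  have h3 : isoNumU a b κ (X * v) v = 0 := by
    rw [h0] at h1
    refine pow_eq_zero_iff (n := 3) (by norm_num) |>.mp ?_
    linear_combination -h1
  rw [h3] at h2
  have hκ := hp.κ_ne_zero h
  refine mul_ne_zero (pow_ne_zero 2 hp.j_ne_zero) (pow_ne_zero 2 (hp.bκ_ne_one h)) ?_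
  have e : κ ^ 3 * (X * (X ^ 2 + b * (1 + b * κ) * (3 - b * κ) * (X + b))) =
      κ * X * ((κ * X) ^ 2 + b * κ * (1 + b * κ) * (3 - b * κ) * (κ * (X + b))) := by ring
  rw [← h2, hX, hX'] at e
  linear_combination e

variable [DecidableEq K]

/-- The formulas for `U / D` and `V / D` compute the products of the coordinates of `P`, `P - Q`
and `P + Q`, and `D` does not vanish where these coordinates are defined. -/
lemma iso_norm (h : GoodFibre a b) (hp : IsogenyParam a b κ w) {X z : K}
    {hn : (curve a b).toAffine.Nonsingular X z} (hX : κ * (X + b) = -1)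
    {P : (curve a b).toAffine.Point} {u₀ v₀ u₁ v₁ u₂ v₂ : K} (h₀ : HasUV P u₀ v₀)
    (h₁ : HasUV (P - Point.some X z hn) u₁ v₁) (h₂ : HasUV (P + Point.some X z hn) u₂ v₂) :
    isoDen a b κ w u₀ v₀ ≠ 0 ∧
    u₀ * u₁ * u₂ * isoDen a b κ w u₀ v₀ = kernelForm b κ u₀ v₀ * isoNumU a b κ u₀ v₀ ∧
    (1 + b * κ) ^ 2 * (v₀ * v₁ * v₂) * isoDen a b κ w u₀ v₀ = kernelForm b κ u₀ v₀ ^ 3 := by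
  have hQ := curve_equation_iff.mp hn.1
  rcases P with _ | ⟨x, y, hP⟩
  · obtain ⟨rfl, rfl⟩ := h₀
    simp [isoDen, kernelForm]
  have hPe := curve_equation_iff.mp hP.1
  obtain ⟨hv₀, rfl⟩ := h₀
  by_cases hx : x = X
  · subst hx
    refine ⟨isoDen_ne_zero_of_kernel h hp hX hv₀ hPe, ?_⟩
    have h12 : (u₁ = 0 ∧ v₁ = 0) ∨ (u₂ = 0 ∧ v₂ = 0) := by
      rcases (Point.X_eq_iff (h₁ := hP) (h₂ := hn)).mp rfl with h3 | h3
      · rw [h3, sub_self] at h₁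
        exact Or.inl (hasUV_zero h₁)
      · rw [h3, neg_add_cancel] at h₂
        exact Or.inr (hasUV_zero h₂)
    rw [kernelForm_eq, hX]
    rcases h12 with ⟨rfl, rfl⟩ | ⟨rfl, rfl⟩ <;> simp
  · have hd : x - X ≠ 0 := sub_ne_zero.mpr hx
    have hκ := hp.κ_ne_zero h
    have he : κ * (x + b) + 1 = κ * (x - X) := by linear_combination hX
    have he0 : κ * (x + b) + 1 ≠ 0 := he ▸ mul_ne_zero hκ hd
    rw [sub_eq_add_neg, Point.neg_some, Point.add_of_X_ne hx] at h₁
    rw [Point.add_of_X_ne hx] at h₂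
    obtain ⟨hv₁, rfl⟩ := exists_of_hasUV_some h₁
    obtain ⟨hv₂, rfl⟩ := exists_of_hasUV_some h₂
    simp only [slope_of_X_ne hx, WeierstrassCurve.Affine.addY, WeierstrassCurve.Affine.negAddY,
      WeierstrassCurve.Affine.negY, WeierstrassCurve.Affine.addX, curve] at hv₁ hv₂ ⊢
    obtain ⟨l, hl⟩ : ∃ l, l = (y - z) / (x - X) := ⟨_, rfl⟩
    obtain ⟨m, hm⟩ : ∃ m, m = (y - (-z - a * X - a * b)) / (x - X) := ⟨_, rfl⟩
    rw [← hm] at hv₁ ⊢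
    rw [← hl] at hv₂ ⊢
    rw [eq_div_iff hd] at hl hm
    have hxx := addX_mul_addX hx hPe hQ hl hm
    have hyy := addY_mul_addY hx hPe hQ hl hm
    have kx := kernel_addX_mul_addX hp (x := x) hX
    have ky := kernel_addY_mul_addY hp hX hPe
    rw [← hxx] at kx
    rw [← hyy, ← isoDen_mul_cube hv₀ hPe] at ky
    have hU := isoNumU_mul_sq (κ := κ) hv₀ hPe
    rw [kernelForm_eq, he]
    generalize l ^ 2 + a * l - b - x - X = x₂ at *
    generalize m ^ 2 + a * m - b - x - X = x₁ at *
    generalize -(m * (x₁ - x) + y) - a * x₁ - a * b = y₁ at *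
    generalize -(l * (x₂ - x) + y) - a * x₂ - a * b = y₂ at *
    generalize isoDen a b κ w (x * v₀) v₀ = D at *
    generalize isoNumU a b κ (x * v₀) v₀ = N at *
    generalize x - X = d at *
    have hj := hp.j_ne_zero
    generalize 1 + b * κ = j at hj kx ky hU ⊢
    have hy0 : y ≠ 0 := right_ne_zero_of_mul_eq_one hv₀
    have hy1 : y₁ ≠ 0 := right_ne_zero_of_mul_eq_one hv₁
    have hy2 : y₂ ≠ 0 := right_ne_zero_of_mul_eq_one hv₂
    obtain rfl : v₀ = 1 / y := by field_simp; linear_combination hv₀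
    obtain rfl : v₁ = 1 / y₁ := by field_simp; linear_combination hv₁
    obtain rfl : v₂ = 1 / y₂ := by field_simp; linear_combination hv₂
    have hD : D = κ ^ 3 * d ^ 3 * y₁ * y₂ / (j ^ 2 * y ^ 2) := by
      field_simp
      refine mul_right_cancel₀ hy0 ?_
      linear_combination -ky
    refine ⟨?_, ?_, ?_⟩
    · rw [hD]
      exact div_ne_zero (mul_ne_zero (mul_ne_zero (mul_ne_zero (pow_ne_zero 3 hκ)
        (pow_ne_zero 3 hd)) hy1) hy2) (mul_ne_zero (pow_ne_zero 2 hj) (pow_ne_zero 2 hy0))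
    · have hN : N = x * (κ ^ 2 * (x₂ * x₁ * d ^ 2)) / (j ^ 2 * y ^ 2) := by
        field_simp
        linear_combination j ^ 2 * hU - x * kx
      rw [hN, hD]
      field_simp
    · rw [hD]
      field_simp

end PointFormulas

/-! ### Parameters on the fibres -/

section Represented

variable {R : Type} [CommRing R] {a b a₂ b₂ κ w : R}

/-- `ψ^* u = U / D` and `ψ^* v = V / D` for the parameters `κ` and `w`. -/
structure PointedMap.Represents (ψ : PointedMap a b a₂ b₂) (κ w : R) : Prop where
  u : ψ.pullback (germ a₂ b₂ (X 0)) * germ a b (isoD a b κ w) = germ a b (isoU a b κ)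
  v : ψ.pullback (germ a₂ b₂ (X 1)) * germ a b (isoD a b κ w) = germ a b (isoV b κ)

/-- Existence of the isogeny with a given parameter, which is then its cotangent factor. -/
lemma exists_represents (h : IsogenyParam a b κ w) (ha : a₂ = a ^ 3 * w ^ 4) (hb : b₂ = b ^ 3) :
    ∃ ψ : PointedMap a b a₂ b₂, ψ.Represents κ w ∧ ψ.HasCotangentFactor κ := by
  subst ha hb
  exact ⟨isoMap h, ⟨isoMap_pullback_u h, isoMap_pullback_v h⟩, isoMap_hasCotangentFactor h⟩

/-- The target of an isogeny is again the source of one: that with parameter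
`κ' = -(b + a² w³) / b⁴`, so that `b⁴ κ κ' = -3`. -/
lemma IsogenyParam.dual (h : IsogenyParam a b κ w) {α β : R} (hα : a * α = 1) (hβ : b * β = 1) :
    IsogenyParam (a ^ 3 * w ^ 4) (b ^ 3) (-(b + a ^ 2 * w ^ 3) * β ^ 4)
      (-b * α ^ 2 * (1 + b * κ) ^ 3) := by
  obtain ⟨hw, hr⟩ := h
  have e1 : b ^ 3 * (-(b + a ^ 2 * w ^ 3) * β ^ 4) = -1 - a ^ 2 * w ^ 3 * β := by
    linear_combination (-(b + a ^ 2 * w ^ 3) * β * (b ^ 2 * β ^ 2 + b * β + 1) - 1) * hβ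
  have e2 : (a ^ 3 * w ^ 4) ^ 2 * (-b * α ^ 2 * (1 + b * κ) ^ 3) ^ 3 = -b ^ 3 * (1 + b * κ) := by
    calc _ = -b ^ 3 * (1 + b * κ) * (a * α) ^ 6 * ((1 + b * κ) * w) ^ 8 := by ring
      _ = _ := by rw [hα, hw]; ring
  constructor
  · rw [e1]
    calc _ = (a * α) ^ 2 * ((1 + b * κ) * w) ^ 3 * (b * β) := by ring
      _ = 1 := by rw [hα, hw, hβ]; ring
  · rw [e2]
    calc _ = (b * β) ^ 4 * (κ * (b + a ^ 2 * w ^ 3)) := by ring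
      _ = 3 := by rw [hβ, hr]; ring

variable {K : Type} [Field K] (φ : R →+* K)

lemma eval₂_isoD (u v : K) : eval₂ φ ![u, v] (isoD a b κ w) =
    isoDen (φ a) (φ b) (φ κ) (φ w) u v := by
  have h := map_isoD (eval₂Hom φ ![u, v]) a b κ w
  simpa using h

lemma eval₂_isoU (u v : K) : eval₂ φ ![u, v] (isoU a b κ) =
    kernelForm (φ b) (φ κ) u v * isoNumU (φ a) (φ b) (φ κ) u v := by
  have h := map_isoU (eval₂Hom φ ![u, v]) a b κ
  simpa using h

lemma eval₂_isoV (u v : K) : eval₂ φ ![u, v] (isoV b κ) = kernelForm (φ b) (φ κ) u v ^ 3 := by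
  have h := map_isoV (eval₂Hom φ ![u, v]) b κ
  simpa using h

/-- The values of a germ with representation `N / D` at a point where `D` does not vanish. -/
lemma GermValue.mul_eq {g : Germ a b} {N D : MvPolynomial (Fin 2) R}
    (hg : g * germ a b D = germ a b N) {u v t : K}
    (hc : v + φ a * u * v + φ a * φ b * v ^ 2 = u ^ 3 + φ b * u ^ 2 * v)
    (ht : GermValue φ g u v t) : t * eval₂ φ ![u, v] D = eval₂ φ ![u, v] N := by
  obtain ⟨F, H, hFH, hH, ht⟩ := ht
  have h := eval₂_mul_eq_of_germ φ hFH hg hc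
  rw [← ht] at h
  refine mul_left_cancel₀ hH ?_
  linear_combination h

/-- The isogeny with parameter `κ` is given on each good fibre by the norm formulas for a point `Q`
with `κ (x(Q) + b) = -1`. -/
lemma PointedMap.Represents.isNormMap [DecidableEq K] {ψ : PointedMap a b a₂ b₂}
    (hψ : ψ.Represents κ w) (hp : IsogenyParam a b κ w) (hg : GoodFibre (φ a) (φ b)) {X z : K}
    {hn : (curve (φ a) (φ b)).toAffine.Nonsingular X z} (hX : φ κ * (X + φ b) = -1) :
    ψ.IsNormMap φ (.some X z hn) := by
  have hp' := hp.map φ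
  refine ⟨WeierstrassCurve.Affine.Point.some_ne_zero hn, three_nsmul_eq_zero hg hp' hX hn,
    (1 + φ b * φ κ) ^ 2, pow_ne_zero 2 hp'.j_ne_zero, ?_⟩
  intro P u₀ v₀ u₁ v₁ u₂ v₂ h₀ h₁ h₂
  obtain ⟨hD, hU, hV⟩ := iso_norm hg hp' hX h₀ h₁ h₂
  refine ⟨fun t ht => ?_, fun t ht => ?_⟩
  · have h := ht.mul_eq φ hψ.u h₀.equation
    rw [eval₂_isoD, eval₂_isoU, ← hU] at h
    exact mul_right_cancel₀ hD h
  · have h := ht.mul_eq φ hψ.v h₀.equation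
    rw [eval₂_isoD, eval₂_isoV, ← hV] at h
    exact mul_right_cancel₀ hD h

end Represented

section Fibres

variable {K : Type} [Field K] {a b κ w κ₁ w₁ : K}

lemma exists_kernel_point [IsAlgClosed K] (h : GoodFibre a b) (hκ : κ ≠ 0) :
    ∃ X z : K, (curve a b).toAffine.Nonsingular X z ∧ κ * (X + b) = -1 := by
  obtain ⟨X, hX⟩ : ∃ X, X = -b - 1 / κ := ⟨_, rfl⟩
  obtain ⟨s, hs⟩ := IsAlgClosed.exists_eq_mul_self
    ((a * X + a * b) ^ 2 + 4 * (X ^ 3 + b * X ^ 2))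
  have h2 := h.two
  refine ⟨X, (s - (a * X + a * b)) / 2, h.nonsingular ?_, ?_⟩
  · field_simp
    linear_combination -hs
  · rw [hX]
    field_simp
    ring

/-- Over an algebraically closed field there is a second subgroup of order three, that is, the
quartic equation of `κ` has a second root. -/
lemma exists_param_ne [IsAlgClosed K] (h : GoodFibre a b) (hp : IsogenyParam a b κ w) :
    ∃ κ₁ w₁ : K, IsogenyParam a b κ₁ w₁ ∧ κ₁ ≠ κ := by
  have hκ := hp.κ_ne_zero h
  have hb := h.hb
  have h1 := hp.mul_sq
  obtain ⟨k, hk⟩ : ∃ k, k = b * κ := ⟨_, rfl⟩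
  rw [← hk] at h1
  have hk0 : k ≠ 0 := hk ▸ mul_ne_zero hb hκ
  -- the quartic equation of `r`, divided by `r - k`
  obtain ⟨r, hr, hrk⟩ : ∃ r, k * r ^ 3 + k ^ 2 * r ^ 2 + (k ^ 3 - 6 * k) * r + 3 = 0 ∧ r ≠ k := by
    have hdeg : (Cubic.toPoly ⟨k, k ^ 2, k ^ 3 - 6 * k, 3⟩).degree ≠ 0 := by
      rw [Cubic.degree_of_a_ne_zero hk0]
      norm_num
    obtain ⟨r, hr⟩ := IsAlgClosed.exists_root _ hdeg
    have hr : k * r ^ 3 + k ^ 2 * r ^ 2 + (k ^ 3 - 6 * k) * r + 3 = 0 := by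
      simpa [Cubic.toPoly] using hr
    by_cases hrk : r = k
    · rw [hrk] at hr
      obtain ⟨s, hs⟩ := IsAlgClosed.exists_eq_mul_self (6 - 2 * k ^ 2)
      have h4 : (4 : K) * k ≠ 0 := by
        have := mul_ne_zero (mul_ne_zero h.two h.two) hk0
        intro h0
        exact this (by linear_combination h0)
      by_cases hsk : -k + s = k
      · refine ⟨-k - s, ?_, fun h0 => h4 (by linear_combination -hsk - h0)⟩
        linear_combination hr - k * (-k - s - k) * hs
      · refine ⟨-k + s, ?_, hsk⟩
        linear_combination hr - k * (-k + s - k) * hs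
    · exact ⟨r, hr, hrk⟩
  have hq : r * a ^ 2 = b * (3 - r) * (1 + r) ^ 3 := by
    refine mul_left_cancel₀ hk0 ?_
    linear_combination b * r * h1 + (a ^ 2 * r) * hk + b * (r - k) * hr
  have hr1 : 1 + r ≠ 0 := by
    intro h0
    rw [h0] at hq
    have : r = -1 := by linear_combination h0
    rw [this] at hq
    exact pow_ne_zero 2 h.ha (by linear_combination -hq)
  refine ⟨r / b, 1 / (1 + r), ⟨?_, ?_⟩, ?_⟩
  · field_simp
  · field_simp
    linear_combination hq
  · intro h0
    apply hrk
    rw [hk, ← h0]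
    field_simp

lemma IsogenyParam.w_eq (hp : IsogenyParam a b κ w) (hp₁ : IsogenyParam a b κ w₁) : w = w₁ :=
  mul_left_cancel₀ hp.j_ne_zero (hp.unit.trans hp₁.unit.symm)

/-- The relation between the parameters of two subgroups of order three. -/
lemma param_cubic (hp : IsogenyParam a b κ w) (hp₁ : IsogenyParam a b κ₁ w₁)
    (hne : κ₁ ≠ κ) : b ^ 4 * κ * κ₁ ^ 3 + b ^ 4 * κ ^ 2 * κ₁ ^ 2 +
      (b ^ 4 * κ ^ 3 - 6 * b ^ 2 * κ) * κ₁ + 3 = 0 := by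
  refine mul_left_cancel₀ (sub_ne_zero.mpr hne) ?_
  linear_combination κ * hp₁.mul_sq - κ₁ * hp.mul_sq

/-- The `x`-coordinate of the image of a point of order three outside the kernel. -/
lemma isoNumU_of_three_torsion (h : GoodFibre a b) (hp : IsogenyParam a b κ w)
    (hp₁ : IsogenyParam a b κ₁ w₁) (hne : κ₁ ≠ κ) {x y v : K} (hx : κ₁ * (x + b) = -1)
    (hv : v * y = 1) (hP : y ^ 2 + a * x * y + a * b * y = x ^ 3 + b * x ^ 2) :
    3 * (isoNumU a b κ (x * v) v + b ^ 3 * kernelForm b κ (x * v) v ^ 2) =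
      b ^ 4 * κ * kernelForm b κ (x * v) v ^ 2 := by
  have hU := isoNumU_mul_sq (κ := κ) hv hP
  have hc := param_cubic hp hp₁ hne
  have hκ₁ := hp₁.κ_ne_zero h
  have hy : y ≠ 0 := right_ne_zero_of_mul_eq_one hv
  have hx' : x = -b - 1 / κ₁ := by
    field_simp
    linear_combination hx
  rw [kernelForm_eq]
  refine mul_right_cancel₀ (pow_ne_zero 2 hy) ?_
  have e : 3 * (x * (x ^ 2 + b * (1 + b * κ) * (3 - b * κ) * (x + b)) +
      b ^ 3 * (κ * (x + b) + 1) ^ 2) = b ^ 4 * κ * (κ * (x + b) + 1) ^ 2 := by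
    rw [hx']
    field_simp
    linear_combination -hc
  linear_combination 3 * hU + e + (3 * b ^ 3 - b ^ 4 * κ) * (κ * (x + b) + 1) ^ 2 *
    (v * y + 1) * hv

/-- A point of order three outside the kernel has its image in the `uv`-chart, away from the
identity. -/
lemma iso_ne_zero_of_three_torsion (h : GoodFibre a b) (hp : IsogenyParam a b κ w)
    (hp₁ : IsogenyParam a b κ₁ w₁) (hne : κ₁ ≠ κ) {x y v : K} (hx : κ₁ * (x + b) = -1)
    (hv : v * y = 1) (hP : y ^ 2 + a * x * y + a * b * y = x ^ 3 + b * x ^ 2) :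
    kernelForm b κ (x * v) v ≠ 0 ∧ isoDen a b κ w (x * v) v ≠ 0 := by
  have hN := isoNumU_of_three_torsion h hp hp₁ hne hx hv hP
  have hc : v + a * (x * v) * v + a * b * v ^ 2 = (x * v) ^ 3 + b * (x * v) ^ 2 * v := by
    linear_combination v ^ 3 * hP - (v + a * x * v ^ 2 + a * b * v ^ 2 + v ^ 2 * y) * hv
  have hE := isoDen_equation hp hc
  have hε : kernelForm b κ (x * v) v ≠ 0 := by
    rw [kernelForm_eq]
    refine mul_ne_zero (fun h0 => hne ?_) (left_ne_zero_of_mul_eq_one hv)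
    have h1 : x + b ≠ 0 := right_ne_zero_of_mul (ne_of_eq_of_ne hx (neg_ne_zero.mpr one_ne_zero))
    refine mul_right_cancel₀ h1 ?_
    linear_combination hx - h0
  refine ⟨hε, fun h0 => ?_⟩
  rw [h0, zero_mul] at hE
  generalize isoNumU a b κ (x * v) v = N at *
  generalize kernelForm b κ (x * v) v = ε at *
  have h1 : N + b ^ 3 * ε ^ 2 ≠ 0 := by
    intro h1
    rw [h1, mul_zero] at hN
    exact mul_ne_zero (mul_ne_zero (pow_ne_zero 4 h.hb) (hp.κ_ne_zero h)) (pow_ne_zero 2 hε) hN.symm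
  have h2 : N = 0 := by
    refine pow_eq_zero_iff (n := 2) (by norm_num) |>.mp ?_
    exact (mul_eq_zero.mp hE.symm).resolve_right h1
  rw [h2] at hN
  refine mul_ne_zero (mul_ne_zero (pow_ne_zero 3 h.hb) (hp.bκ_ne_three h)) (pow_ne_zero 2 hε) ?_
  linear_combination hN

/-- The target of an isogeny is an elliptic curve. -/
lemma GoodFibre.target (h : GoodFibre a b) (hp : IsogenyParam a b κ w) :
    GoodFibre (a ^ 3 * w ^ 4) (b ^ 3) := by
  refine ⟨h.two, h.three, mul_ne_zero (pow_ne_zero 3 h.ha) (pow_ne_zero 4 hp.w_ne_zero),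
    pow_ne_zero 3 h.hb, fun h0 => ?_⟩
  have h1 := hp.mul_sq
  have hκ := hp.κ_ne_zero h
  have hw := hp.unit
  have h2 : κ ^ 3 * a ^ 6 * w ^ 8 = (3 - b * κ) ^ 3 * (1 + b * κ) := by
    calc κ ^ 3 * a ^ 6 * w ^ 8 = (κ * a ^ 2) ^ 3 * w ^ 8 := by ring
      _ = (3 - b * κ) ^ 3 * (1 + b * κ) * ((1 + b * κ) * w) ^ 8 := by rw [h1]; ring
      _ = _ := by rw [hw]; ring
  have h3 : (b * κ - 1) * (b * κ + 3) ^ 3 = 0 := by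
    linear_combination h2 - κ ^ 3 * h0
  rcases mul_eq_zero.mp h3 with h4 | h4
  · exact hp.bκ_ne_one h h4
  · have h5 : b * κ = -3 := by
      have := pow_eq_zero_iff (n := 3) (by norm_num) |>.mp h4
      linear_combination this
    rw [h5] at h1
    refine mul_ne_zero h.three h.disc ?_
    linear_combination -b * h1 + a ^ 2 * h5

end Fibres

/-! ### Morphisms given by the norm formulas -/

section Uniqueness

open WeierstrassCurve.Affine

variable {K : Type} [Field K] {a b κ w : K}

/-- Where the denominator does not vanish, `P - Q` and `P + Q` lie in the `uv`-chart. -/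
lemma exists_hasUV_of_isoDen_ne_zero [DecidableEq K] (hp : IsogenyParam a b κ w) {X z x y v : K}
    {hn : (curve a b).toAffine.Nonsingular X z} (hX : κ * (X + b) = -1)
    {hP : (curve a b).toAffine.Nonsingular x y} (hv : v * y = 1) (hx : x ≠ X)
    (hD : isoDen a b κ w (x * v) v ≠ 0) :
    ∃ u₁ v₁ u₂ v₂, HasUV (Point.some x y hP - Point.some X z hn) u₁ v₁ ∧
      HasUV (Point.some x y hP + Point.some X z hn) u₂ v₂ := by
  have hQ := curve_equation_iff.mp hn.1
  have hPe := curve_equation_iff.mp hP.1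
  have hd : x - X ≠ 0 := sub_ne_zero.mpr hx
  obtain ⟨l, hl⟩ : ∃ l, l = (y - z) / (x - X) := ⟨_, rfl⟩
  obtain ⟨m, hm⟩ : ∃ m, m = (y - (-z - a * X - a * b)) / (x - X) := ⟨_, rfl⟩
  have hyy := addY_mul_addY hx hPe hQ ((eq_div_iff hd).mp hl) ((eq_div_iff hd).mp hm)
  have ky := kernel_addY_mul_addY hp hX hPe
  rw [← hyy, ← isoDen_mul_cube hv hPe] at ky
  have hy : y ≠ 0 := right_ne_zero_of_mul_eq_one hv
  have h0 := mul_ne_zero (pow_ne_zero 2 hp.j_ne_zero) (mul_ne_zero hD (pow_ne_zero 3 hy))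
  rw [← ky] at h0
  have h1 := left_ne_zero_of_mul (right_ne_zero_of_mul (right_ne_zero_of_mul h0))
  have hy2 := left_ne_zero_of_mul h1
  have hy1 := right_ne_zero_of_mul h1
  rw [sub_eq_add_neg, Point.neg_some, Point.add_of_X_ne hx, Point.add_of_X_ne hx]
  refine ⟨_, _, _, _, ⟨inv_mul_cancel₀ ?_, rfl⟩, ⟨inv_mul_cancel₀ ?_, rfl⟩⟩
  · simpa only [slope_of_X_ne hx, WeierstrassCurve.Affine.addY, WeierstrassCurve.Affine.negAddY,
      WeierstrassCurve.Affine.negY, WeierstrassCurve.Affine.addX, curve, ← hm] using hy1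
  · simpa only [slope_of_X_ne hx, WeierstrassCurve.Affine.addY, WeierstrassCurve.Affine.negAddY,
      WeierstrassCurve.Affine.negY, WeierstrassCurve.Affine.addX, curve, ← hl] using hy2

/-- The polynomial `U` of the fibre, as a polynomial in `u` over `K[v]`. -/
def bivU (a b κ : K) : Polynomial (Polynomial K) := toBiv (RingHom.id K) (isoU a b κ)

/-- The polynomial `V` of the fibre, as a polynomial in `u` over `K[v]`. -/
def bivV (b κ : K) : Polynomial (Polynomial K) := toBiv (RingHom.id K) (isoV b κ)

/-- The polynomial `D` of the fibre, as a polynomial in `u` over `K[v]`. -/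
def bivD (a b κ w : K) : Polynomial (Polynomial K) := toBiv (RingHom.id K) (isoD a b κ w)

lemma evalEval_bivU (u v : K) : (bivU a b κ).evalEval v u =
    kernelForm b κ u v * isoNumU a b κ u v := by
  rw [bivU, evalEval_toBiv, eval₂_isoU]
  rfl

lemma evalEval_bivV (u v : K) : (bivV b κ).evalEval v u = kernelForm b κ u v ^ 3 := by
  rw [bivV, evalEval_toBiv, eval₂_isoV]
  rfl

lemma evalEval_bivD (u v : K) : (bivD a b κ w).evalEval v u = isoDen a b κ w u v := by
  rw [bivD, evalEval_toBiv, eval₂_isoD]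
  rfl

lemma not_dvd_bivD (a' b' : K) : ¬ uvCubic a' b' ∣ bivD a b κ w :=
  uvCubic_not_dvd_of_isUnit _ (by rw [constantCoeff_isoD]; exact isUnit_one)

lemma not_uvCubic_dvd_C {p : Polynomial K} (hp : p ≠ 0) : ¬ uvCubic a b ∣ Polynomial.C p := by
  refine (monic_uvCubic a b).not_dvd_of_natDegree_lt (Polynomial.C_ne_zero.mpr hp) ?_
  rw [natDegree_uvCubic, Polynomial.natDegree_C]
  norm_num

lemma not_uvCubic_dvd_X_sub_C (p : Polynomial K) :
    ¬ uvCubic a b ∣ Polynomial.X - Polynomial.C p := by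
  refine (monic_uvCubic a b).not_dvd_of_natDegree_lt (Polynomial.X_sub_C_ne_zero p) ?_
  rw [natDegree_uvCubic, Polynomial.natDegree_X_sub_C]
  norm_num

/-- A polynomial that vanishes wherever the addition formulas for `P - Q` and `P + Q` apply is
divisible by the equation of the curve. -/
lemma uvCubic_dvd_of_forall_hasUV [IsAlgClosed K] [DecidableEq K] (h : GoodFibre a b)
    (hp : IsogenyParam a b κ w) {X z : K} {hn : (curve a b).toAffine.Nonsingular X z}
    (hX : κ * (X + b) = -1) {G H : Polynomial (Polynomial K)} (hH : ¬ uvCubic a b ∣ H)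
    (hG : ∀ (P : (curve a b).toAffine.Point) (u₀ v₀ u₁ v₁ u₂ v₂ : K), HasUV P u₀ v₀ →
      HasUV (P - Point.some X z hn) u₁ v₁ → HasUV (P + Point.some X z hn) u₂ v₂ →
      H.evalEval v₀ u₀ ≠ 0 → G.evalEval v₀ u₀ = 0) : uvCubic a b ∣ G := by
  have hd : uvCubic a b ∣ G * (H * (Polynomial.C Polynomial.X *
      ((Polynomial.X - Polynomial.C (Polynomial.C X * Polynomial.X)) * bivD a b κ w))) := by
    refine uvCubic_dvd_of_forall fun u v hc => ?_
    simp only [Polynomial.evalEval_mul, Polynomial.evalEval_sub, Polynomial.evalEval_X,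
      Polynomial.evalEval_C, Polynomial.eval_X, Polynomial.eval_mul, Polynomial.eval_C,
      evalEval_bivD]
    by_cases hHu : H.evalEval v u = 0
    · rw [hHu]; ring
    by_cases hv : v = 0
    · rw [hv]; ring
    by_cases hx : u - X * v = 0
    · rw [hx]; ring
    by_cases hD : isoDen a b κ w u v = 0
    · rw [hD]; ring
    have hu : u = u / v * v := by field_simp
    have hP : (curve a b).toAffine.Nonsingular (u / v) (1 / v) := by
      refine h.nonsingular ?_
      field_simp
      linear_combination hc
    have hv1 : v * (1 / v) = 1 := by field_simp
    rw [hu] at hD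
    obtain ⟨u₁, v₁, u₂, v₂, h₁, h₂⟩ := exists_hasUV_of_isoDen_ne_zero (hP := hP) (hn := hn) hp hX
      hv1
      (fun h0 => hx (by rw [← h0]; field_simp; ring)) hD
    rw [hG (Point.some _ _ hP) u v u₁ v₁ u₂ v₂ ⟨hv1, hu⟩ h₁ h₂ hHu, zero_mul]
  have hprime := prime_uvCubic a b
  refine (hprime.dvd_or_dvd hd).resolve_right fun h1 => ?_
  rcases hprime.dvd_or_dvd h1 with h1 | h1
  · exact hH h1
  rcases hprime.dvd_or_dvd h1 with h1 | h1
  · exact not_uvCubic_dvd_C Polynomial.X_ne_zero h1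
  rcases hprime.dvd_or_dvd h1 with h1 | h1
  · exact not_uvCubic_dvd_X_sub_C _ h1
  · exact not_dvd_bivD _ _ h1

/-- The morphism `R[ε] → K[ε]` induced by `R → K`. -/
def dualMap {R : Type} [CommRing R] (φ : R →+* K) : DualNumber R →+* DualNumber K where
  toFun x := TrivSqZeroExt.inl (φ x.fst) + TrivSqZeroExt.inr (φ x.snd)
  map_one' := by simp
  map_mul' x y := by ext <;> simp
  map_zero' := by simp
  map_add' x y := by ext <;> simp

lemma fst_dualMap {R : Type} [CommRing R] (φ : R →+* K) (x : DualNumber R) :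
    TrivSqZeroExt.fst (dualMap φ x) = φ x.fst := by
  simp [dualMap]

lemma dualMap_inr {R : Type} [CommRing R] (φ : R →+* K) (r : R) :
    dualMap φ (TrivSqZeroExt.inr r) = TrivSqZeroExt.inr (φ r) := by
  simp [dualMap]

lemma dualMap_inl {R : Type} [CommRing R] (φ : R →+* K) (r : R) :
    dualMap φ (TrivSqZeroExt.inl r) = TrivSqZeroExt.inl (φ r) := by
  simp [dualMap]

/-- Evaluation of polynomials in `u` and `v` at `(ε, 0)`. -/
def evalEps : Polynomial (Polynomial K) →+* DualNumber K :=
  Polynomial.eval₂RingHom ((algebraMap K (DualNumber K)).comp (Polynomial.evalRingHom 0))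
    DualNumber.eps

lemma evalEps_uvCubic : evalEps (uvCubic a b) = 0 := by
  simp [evalEps, uvCubic, pow_succ]

lemma evalEps_toBiv {R : Type} [CommRing R] (φ : R →+* K) (F : MvPolynomial (Fin 2) R) :
    evalEps (toBiv φ F) = dualMap φ (aeval ![(DualNumber.eps : DualNumber R), 0] F) := by
  have h : (evalEps (K := K)).comp (toBiv φ) =
      (dualMap φ).comp (aeval ![(DualNumber.eps : DualNumber R), 0] :
        MvPolynomial (Fin 2) R →ₐ[R] DualNumber R) := by
    refine MvPolynomial.ringHom_ext (fun r => ?_) (fun i => ?_)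
    · simp [evalEps, toBiv_C, TrivSqZeroExt.algebraMap_eq_inl, dualMap_inl]
    · fin_cases i
      · change evalEps (toBiv φ (X 0)) = dualMap φ (aeval _ (X 0))
        rw [toBiv_X_zero, aeval_X, Matrix.cons_val_zero, DualNumber.eps, dualMap_inr, map_one,
          evalEps, Polynomial.coe_eval₂RingHom, Polynomial.eval₂_X, DualNumber.eps]
      · simp [evalEps, toBiv_X_one]
  exact DFunLike.congr_fun h F

section NormMap

variable {R : Type} [CommRing R] {a b a₂ b₂ : R} {φ : R →+* K} {κ w : K}

/-- A morphism given by the norm formulas pulls `u` back to `U / D`. -/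
lemma PointedMap.IsNormMap.dvd_u [IsAlgClosed K] [DecidableEq K] {ψ : PointedMap a b a₂ b₂}
    {x₀ z₀ : K} {hn : (curve (φ a) (φ b)).toAffine.Nonsingular x₀ z₀}
    (hψ : ψ.IsNormMap φ (.some x₀ z₀ hn)) (h : GoodFibre (φ a) (φ b))
    (hp : IsogenyParam (φ a) (φ b) κ w) (hX : κ * (x₀ + φ b) = -1)
    {F H : MvPolynomial (Fin 2) R} (hFH : ψ.pullback (germ a₂ b₂ (X 0)) * germ a b H = germ a b F)
    (hH : ¬ uvCubic (φ a) (φ b) ∣ toBiv φ H) :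
    uvCubic (φ a) (φ b) ∣
      toBiv φ F * bivD (φ a) (φ b) κ w - bivU (φ a) (φ b) κ * toBiv φ H := by
  obtain ⟨-, -, μ, -, hN⟩ := hψ
  refine uvCubic_dvd_of_forall_hasUV h hp (hn := hn) hX hH
    fun P u₀ v₀ u₁ v₁ u₂ v₂ h₀ h₁ h₂ hH0 => ?_
  obtain ⟨-, hU, -⟩ := iso_norm h hp hX h₀ h₁ h₂
  rw [evalEval_toBiv] at hH0
  have ht := (hN P u₀ v₀ u₁ v₁ u₂ v₂ h₀ h₁ h₂).1
    (eval₂ φ ![u₀, v₀] F / eval₂ φ ![u₀, v₀] H) ⟨F, H, hFH, hH0, mul_div_cancel₀ _ hH0⟩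
  rw [div_eq_iff hH0] at ht
  rw [Polynomial.evalEval_sub, Polynomial.evalEval_mul, Polynomial.evalEval_mul, evalEval_toBiv,
    evalEval_toBiv, evalEval_bivD, evalEval_bivU, ht]
  linear_combination eval₂ φ ![u₀, v₀] H * hU

/-- A morphism given by the norm formulas pulls `v` back to a constant multiple of `V / D`. -/
lemma PointedMap.IsNormMap.exists_dvd_v [IsAlgClosed K] [DecidableEq K]
    {ψ : PointedMap a b a₂ b₂}
    {x₀ z₀ : K} {hn : (curve (φ a) (φ b)).toAffine.Nonsingular x₀ z₀}
    (hψ : ψ.IsNormMap φ (.some x₀ z₀ hn)) (h : GoodFibre (φ a) (φ b))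
    (hp : IsogenyParam (φ a) (φ b) κ w) (hX : κ * (x₀ + φ b) = -1) :
    ∃ c : K, ∀ F H : MvPolynomial (Fin 2) R,
      ψ.pullback (germ a₂ b₂ (X 1)) * germ a b H = germ a b F →
      ¬ uvCubic (φ a) (φ b) ∣ toBiv φ H → uvCubic (φ a) (φ b) ∣ toBiv φ F * bivD (φ a) (φ b) κ w -
        Polynomial.C (Polynomial.C c) * bivV (φ b) κ * toBiv φ H := by
  obtain ⟨-, -, μ, -, hN⟩ := hψ
  have hj := hp.j_ne_zero
  refine ⟨μ / (1 + φ b * κ) ^ 2, fun F H hFH hH => ?_⟩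
  refine uvCubic_dvd_of_forall_hasUV h hp (hn := hn) hX hH
    fun P u₀ v₀ u₁ v₁ u₂ v₂ h₀ h₁ h₂ hH0 => ?_
  obtain ⟨-, -, hV⟩ := iso_norm h hp hX h₀ h₁ h₂
  rw [evalEval_toBiv] at hH0
  have ht := (hN P u₀ v₀ u₁ v₁ u₂ v₂ h₀ h₁ h₂).2
    (eval₂ φ ![u₀, v₀] F / eval₂ φ ![u₀, v₀] H) ⟨F, H, hFH, hH0, mul_div_cancel₀ _ hH0⟩
  rw [div_eq_iff hH0] at ht
  rw [Polynomial.evalEval_sub, Polynomial.evalEval_mul, Polynomial.evalEval_mul,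
    Polynomial.evalEval_mul, evalEval_toBiv,
    evalEval_toBiv, evalEval_bivD, evalEval_bivV, Polynomial.evalEval_C, Polynomial.eval_C, ht]
  generalize 1 + φ b * κ = j at *
  field_simp
  linear_combination μ * eval₂ φ ![u₀, v₀] H * hV

/-- The cotangent factor of a morphism given by the norm formulas for `Q` is `u(Q) u(-Q)`. -/
lemma PointedMap.IsNormMap.cotangentFactor_eq [IsAlgClosed K] [DecidableEq K]
    {ψ : PointedMap a b a₂ b₂} {x₀ z₀ : K} {hn : (curve (φ a) (φ b)).toAffine.Nonsingular x₀ z₀}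
    (hψ : ψ.IsNormMap φ (.some x₀ z₀ hn)) (h : GoodFibre (φ a) (φ b))
    (hp : IsogenyParam (φ a) (φ b) κ w) (hX : κ * (x₀ + φ b) = -1) {k : R}
    (hk : ψ.HasCotangentFactor k) : φ k = κ := by
  obtain ⟨F, H, hH, hFH⟩ := exists_germ_fraction (ψ.pullback (germ a₂ b₂ (X 0)))
  obtain ⟨G, hG⟩ := hψ.dvd_u h hp hX hFH (uvCubic_not_dvd_of_isUnit φ hH)
  have h1 := congrArg evalEps hG
  have h2 := congrArg (firstOrder a b) hFH
  rw [map_mul, hk.firstOrder_eq, firstOrder_germ, firstOrder_germ] at h2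
  rw [map_sub, map_mul, map_mul, map_mul, evalEps_uvCubic, zero_mul, evalEps_toBiv, evalEps_toBiv,
    bivU, bivD, evalEps_toBiv, evalEps_toBiv, aeval_eps_isoU, ← h2, map_mul, dualMap_inr,
    dualMap_inr, sub_eq_zero, RingHom.id_apply] at h1
  have h3 := congrArg TrivSqZeroExt.snd h1
  have hD : TrivSqZeroExt.fst (dualMap (RingHom.id K)
      (aeval ![(DualNumber.eps : DualNumber K), 0] (isoD (φ a) (φ b) κ w))) = 1 := by
    rw [fst_dualMap, fst_aeval_eps, constantCoeff_isoD, map_one]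
  have hH' : TrivSqZeroExt.fst (dualMap φ (aeval ![(DualNumber.eps : DualNumber R), 0] H)) ≠ 0 := by
    rw [fst_dualMap, fst_aeval_eps]
    exact (hH.map φ).ne_zero
  generalize dualMap φ (aeval ![(DualNumber.eps : DualNumber R), 0] H) = p at *
  generalize dualMap (RingHom.id K)
    (aeval ![(DualNumber.eps : DualNumber K), 0] (isoD (φ a) (φ b) κ w)) = q at *
  simp [hD] at h3
  exact h3.resolve_right hH'

lemma not_uvCubic_dvd_bivV (hκ : κ ≠ 0) (a' b' : K) : ¬ uvCubic a' b' ∣ bivV (φ b) κ := by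
  intro h1
  rw [bivV, isoV, map_pow] at h1
  obtain ⟨G, hG⟩ := (prime_uvCubic a' b').dvd_of_dvd_pow h1
  have h2 := congrArg TrivSqZeroExt.snd (congrArg evalEps hG)
  rw [map_mul, evalEps_uvCubic, zero_mul, evalEps_toBiv] at h2
  refine hκ ?_
  simpa [kernelForm, dualMap, TrivSqZeroExt.algebraMap_eq_inl] using h2

/-- If the target has the expected coefficients, then the scalar in the norm formula for `v` is
the expected one: a different multiple of `V / D` would not satisfy the equation of the target. -/
lemma PointedMap.IsNormMap.dvd_v [IsAlgClosed K] [DecidableEq K]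
    {ψ : PointedMap a b a₂ b₂}
    {x₀ z₀ : K} {hn : (curve (φ a) (φ b)).toAffine.Nonsingular x₀ z₀}
    (hψ : ψ.IsNormMap φ (.some x₀ z₀ hn)) (h : GoodFibre (φ a) (φ b))
    (hp : IsogenyParam (φ a) (φ b) κ w) (hX : κ * (x₀ + φ b) = -1)
    (ha₂ : φ a₂ = φ a ^ 3 * w ^ 4) (hb₂ : φ b₂ = φ b ^ 3)
    {F H : MvPolynomial (Fin 2) R}
    (hFH : ψ.pullback (germ a₂ b₂ (X 1)) * germ a b H = germ a b F)
    (hH : ¬ uvCubic (φ a) (φ b) ∣ toBiv φ H) :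
    uvCubic (φ a) (φ b) ∣
      toBiv φ F * bivD (φ a) (φ b) κ w - bivV (φ b) κ * toBiv φ H := by
  obtain ⟨c, hv⟩ := hψ.exists_dvd_v h hp hX
  suffices hc1 : c = 1 by
    have := hv F H hFH hH
    rwa [hc1, map_one, map_one, one_mul] at this
  -- write `ψ^* u = F₁ / H₁` and `ψ^* v = F / H`; both `U / D`, `V / D` and `U / D`, `c V / D`
  -- satisfy the equation of the target, and the difference of the two equations is a multiple
  -- of `c - 1` whose other factors do not vanish identically on the curve
  obtain ⟨F₁, H₁, hH₁, hFH₁⟩ := exists_germ_fraction (ψ.pullback (germ a₂ b₂ (X 0)))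
  have hu := hψ.dvd_u h hp hX hFH₁ (uvCubic_not_dvd_of_isUnit φ hH₁)
  replace hH₁ := uvCubic_not_dvd_of_isUnit φ (a := φ a) (b := φ b) hH₁
  replace hv := hv F H hFH hH
  -- the equation of the target, satisfied by the pull-backs of `u` and `v`
  have hE : germ a b (F * H * H₁ ^ 3 + C a₂ * F₁ * F * H₁ ^ 2 * H + C (a₂ * b₂) * F ^ 2 * H₁ ^ 3 -
      (F₁ ^ 3 * H ^ 2 + C b₂ * F₁ ^ 2 * F * H₁ * H)) = 0 := by
    have h0 := congrArg ψ.pullback (germ_uvEquation a₂ b₂)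
    have hC : ∀ r : R, germ a b (C r) = ψ.pullback (germ a₂ b₂ (C r)) := fun r => by
      rw [germ_C, germ_C, AlgHom.commutes]
    rw [← germHom_apply, uvEquation] at h0
    rw [← germHom_apply]
    simp only [map_sub, map_add, map_mul, map_pow, map_zero] at h0 ⊢
    simp only [germHom_apply] at h0 ⊢
    rw [← hFH, ← hFH₁, hC, hC]
    linear_combination germ a b H ^ 2 * germ a b H₁ ^ 3 * h0
  have hE' := dvd_toBiv_of_germ_eq_zero φ hE
  simp only [map_sub, map_add, map_mul, map_pow, toBiv_C] at hE'
  have hiso : uvCubic (φ a) (φ b) ∣ bivV (φ b) κ * bivD (φ a) (φ b) κ w ^ 2 +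
      Polynomial.C (Polynomial.C (φ a₂)) * bivU (φ a) (φ b) κ * bivV (φ b) κ *
        bivD (φ a) (φ b) κ w + Polynomial.C (Polynomial.C (φ a₂)) *
        Polynomial.C (Polynomial.C (φ b₂)) * bivV (φ b) κ ^ 2 * bivD (φ a) (φ b) κ w -
      (bivU (φ a) (φ b) κ ^ 3 + Polynomial.C (Polynomial.C (φ b₂)) *
        bivU (φ a) (φ b) κ ^ 2 * bivV (φ b) κ) := by
    refine uvCubic_dvd_of_forall fun u v huv => ?_
    have := iso_uvEquation hp huv
    simp only [Polynomial.evalEval_sub, Polynomial.evalEval_add, Polynomial.evalEval_mul,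
      Polynomial.evalEval_pow, Polynomial.evalEval_C, Polynomial.eval_C, evalEval_bivU,
      evalEval_bivV, evalEval_bivD, ha₂, hb₂]
    linear_combination this
  have hprime := prime_uvCubic (φ a) (φ b)
  have : IsDomain (AdjoinRoot (uvCubic (φ a) (φ b))) := AdjoinRoot.isDomain_of_prime hprime
  have hV0 := not_uvCubic_dvd_bivV (φ := φ) (b := b) (hp.κ_ne_zero h) (φ a) (φ b)
  have hD0 := not_dvd_bivD (a := φ a) (b := φ b) (κ := κ) (w := w) (φ a) (φ b)
  by_contra hc1
  have key : ¬ uvCubic (φ a) (φ b) ∣ bivD (φ a) (φ b) κ w ^ 2 +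
      Polynomial.C (Polynomial.C (φ a₂)) * bivU (φ a) (φ b) κ * bivD (φ a) (φ b) κ w +
      Polynomial.C (Polynomial.C (φ a₂)) * Polynomial.C (Polynomial.C (φ b₂)) *
        (Polynomial.C (Polynomial.C c) + 1) * bivV (φ b) κ * bivD (φ a) (φ b) κ w -
      Polynomial.C (Polynomial.C (φ b₂)) * bivU (φ a) (φ b) κ ^ 2 := by
    rintro ⟨G, hG⟩
    have := congrArg (Polynomial.evalEval 0 0) hG
    simp [evalEval_bivU, evalEval_bivV, evalEval_bivD, evalEval_uvCubic, kernelForm,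
      isoDen] at this
  refine key ?_
  have hcc : ¬ uvCubic (φ a) (φ b) ∣ Polynomial.C (Polynomial.C c - 1) := by
    refine not_uvCubic_dvd_C ?_
    rw [← map_one Polynomial.C, ← map_sub, Ne, Polynomial.C_eq_zero, sub_eq_zero]
    exact hc1
  rw [map_sub, map_one] at hcc
  rw [← AdjoinRoot.mk_eq_zero] at hu hv hE' hiso hcc hH₁ hH hV0 hD0 ⊢
  simp only [map_sub, map_add, map_mul, map_pow, map_one] at *
  generalize AdjoinRoot.mk (uvCubic (φ a) (φ b)) (toBiv φ F) = f at *
  generalize AdjoinRoot.mk (uvCubic (φ a) (φ b)) (toBiv φ H) = g at *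
  generalize AdjoinRoot.mk (uvCubic (φ a) (φ b)) (toBiv φ F₁) = f₁ at *
  generalize AdjoinRoot.mk (uvCubic (φ a) (φ b)) (toBiv φ H₁) = g₁ at *
  generalize AdjoinRoot.mk (uvCubic (φ a) (φ b)) (bivU (φ a) (φ b) κ) = U at *
  generalize AdjoinRoot.mk (uvCubic (φ a) (φ b)) (bivV (φ b) κ) = V at *
  generalize AdjoinRoot.mk (uvCubic (φ a) (φ b)) (bivD (φ a) (φ b) κ w) = D at *
  generalize AdjoinRoot.mk (uvCubic (φ a) (φ b)) (Polynomial.C (Polynomial.C c)) = γ at *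
  generalize AdjoinRoot.mk (uvCubic (φ a) (φ b)) (Polynomial.C (Polynomial.C (φ a₂))) = α at *
  generalize AdjoinRoot.mk (uvCubic (φ a) (φ b)) (Polynomial.C (Polynomial.C (φ b₂))) = β at *
  have h1 : γ * V * D ^ 2 + α * γ * U * V * D + α * β * γ ^ 2 * V ^ 2 * D -
      U ^ 3 - β * γ * U ^ 2 * V = 0 := by
    refine mul_left_cancel₀ (mul_ne_zero (pow_ne_zero 2 hH) (pow_ne_zero 3 hH₁)) ?_
    have hv' : f * D = γ * V * g := sub_eq_zero.mp hv
    have hu' : f₁ * D = U * g₁ := sub_eq_zero.mp hu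
    have h0 : D ^ 2 * (f * D) * g * g₁ ^ 3 + α * D * (f₁ * D) * (f * D) * g₁ ^ 2 * g +
        α * β * D * (f * D) ^ 2 * g₁ ^ 3 -
        ((f₁ * D) ^ 3 * g ^ 2 + β * (f₁ * D) ^ 2 * (f * D) * g₁ * g) = 0 := by
      linear_combination D ^ 3 * hE'
    rw [hv', hu'] at h0
    linear_combination h0
  refine mul_left_cancel₀ (mul_ne_zero hcc hV0) ?_
  linear_combination h1 - hiso

lemma not_dvd_of_eval₂_ne_zero {H : MvPolynomial (Fin 2) R} {u v : K}
    (hc : v + φ a * u * v + φ a * φ b * v ^ 2 = u ^ 3 + φ b * u ^ 2 * v)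
    (hH : eval₂ φ ![u, v] H ≠ 0) : ¬ uvCubic (φ a) (φ b) ∣ toBiv φ H := by
  rintro ⟨G, hG⟩
  have h1 := congrArg (Polynomial.evalEval v u) hG
  rw [evalEval_toBiv, Polynomial.evalEval_mul, evalEval_uvCubic, ← hc, sub_self, zero_mul] at h1
  exact hH h1

lemma PointedMap.IsNormMap.value_u [IsAlgClosed K] [DecidableEq K] {ψ : PointedMap a b a₂ b₂}
    {x₀ z₀ : K} {hn : (curve (φ a) (φ b)).toAffine.Nonsingular x₀ z₀}
    (hψ : ψ.IsNormMap φ (.some x₀ z₀ hn)) (h : GoodFibre (φ a) (φ b))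
    (hp : IsogenyParam (φ a) (φ b) κ w) (hX : κ * (x₀ + φ b) = -1) {u v t : K}
    (hc : v + φ a * u * v + φ a * φ b * v ^ 2 = u ^ 3 + φ b * u ^ 2 * v)
    (ht : GermValue φ (ψ.pullback (germ a₂ b₂ (X 0))) u v t) :
    t * isoDen (φ a) (φ b) κ w u v = kernelForm (φ b) κ u v * isoNumU (φ a) (φ b) κ u v := by
  obtain ⟨F, H, hFH, hH, ht⟩ := ht
  obtain ⟨G, hG⟩ := hψ.dvd_u h hp hX hFH (not_dvd_of_eval₂_ne_zero hc hH)
  have h1 := congrArg (Polynomial.evalEval v u) hG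
  rw [Polynomial.evalEval_mul, evalEval_uvCubic, ← hc, sub_self, zero_mul, Polynomial.evalEval_sub,
    Polynomial.evalEval_mul, Polynomial.evalEval_mul, evalEval_toBiv, evalEval_toBiv,
    evalEval_bivD, evalEval_bivU, ← ht] at h1
  refine mul_left_cancel₀ hH ?_
  linear_combination h1

lemma PointedMap.IsNormMap.value_v [IsAlgClosed K] [DecidableEq K] {ψ : PointedMap a b a₂ b₂}
    {x₀ z₀ : K} {hn : (curve (φ a) (φ b)).toAffine.Nonsingular x₀ z₀}
    (hψ : ψ.IsNormMap φ (.some x₀ z₀ hn)) (h : GoodFibre (φ a) (φ b))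
    (hp : IsogenyParam (φ a) (φ b) κ w) (hX : κ * (x₀ + φ b) = -1)
    (ha₂ : φ a₂ = φ a ^ 3 * w ^ 4) (hb₂ : φ b₂ = φ b ^ 3) {u v t : K}
    (hc : v + φ a * u * v + φ a * φ b * v ^ 2 = u ^ 3 + φ b * u ^ 2 * v)
    (ht : GermValue φ (ψ.pullback (germ a₂ b₂ (X 1))) u v t) :
    t * isoDen (φ a) (φ b) κ w u v = kernelForm (φ b) κ u v ^ 3 := by
  obtain ⟨F, H, hFH, hH, ht⟩ := ht
  obtain ⟨G, hG⟩ := hψ.dvd_v h hp hX ha₂ hb₂ hFH (not_dvd_of_eval₂_ne_zero hc hH)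
  have h1 := congrArg (Polynomial.evalEval v u) hG
  rw [Polynomial.evalEval_mul, evalEval_uvCubic, ← hc, sub_self, zero_mul, Polynomial.evalEval_sub,
    Polynomial.evalEval_mul, Polynomial.evalEval_mul, evalEval_toBiv, evalEval_toBiv,
    evalEval_bivD, evalEval_bivV, ← ht] at h1
  refine mul_left_cancel₀ hH ?_
  linear_combination h1

/-- The nonzero points in the image of the points of order three have `x + b³ = b⁴ κ / 3`. -/
lemma PointedMap.IsNormMap.image_three_torsion [IsAlgClosed K] [DecidableEq K]
    {ψ : PointedMap a b a₂ b₂} {x₀ z₀ : K}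
    {hn : (curve (φ a) (φ b)).toAffine.Nonsingular x₀ z₀}
    (hψ : ψ.IsNormMap φ (.some x₀ z₀ hn)) (h : GoodFibre (φ a) (φ b))
    (hp : IsogenyParam (φ a) (φ b) κ w) (hX : κ * (x₀ + φ b) = -1)
    (ha₂ : φ a₂ = φ a ^ 3 * w ^ 4) (hb₂ : φ b₂ = φ b ^ 3)
    {T : FibrePoint φ a b} (hT : 3 • T = 0) {x y : K}
    {hn₂ : (curve (φ a₂) (φ b₂)).toAffine.Nonsingular x y}
    (hTQ : ψ.MapsTo φ T (.some x y hn₂)) : 3 * (x + φ b ^ 3) = φ b ^ 4 * κ := by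
  obtain ⟨u, v, u₂, v₂, hTuv, ⟨hv₂y, hu₂⟩, hu, hv⟩ := hTQ
  have hc := hTuv.equation
  have hU := hψ.value_u h hp hX hc hu
  have hV := hψ.value_v h hp hX ha₂ hb₂ hc hv
  have hv₂ : v₂ ≠ 0 := left_ne_zero_of_mul_eq_one hv₂y
  by_cases hT0 : T = 0
  · exfalso
    subst hT0
    obtain ⟨rfl, rfl⟩ := hasUV_zero hTuv
    refine hv₂ ?_
    simpa [isoDen, kernelForm] using hV
  obtain ⟨x₁, y₁, hn₁, κ₁, w₁, rfl, hp₁, hx₁⟩ := exists_param_of_three_nsmul h hT0 hT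
  have hP := curve_equation_iff.mp hn₁.1
  obtain ⟨hvy, rfl⟩ := exists_of_hasUV_some hTuv
  by_cases hne : κ₁ = κ
  · exfalso
    subst hne
    have hD := isoDen_ne_zero_of_kernel h hp hx₁ hvy hP
    rw [kernelForm_eq, hx₁, neg_add_cancel, zero_mul, zero_pow (by norm_num)] at hV
    exact mul_ne_zero hv₂ hD hV
  obtain ⟨hε, hD⟩ := iso_ne_zero_of_three_torsion h hp hp₁ hne hx₁ hvy hP
  have hN := isoNumU_of_three_torsion h hp hp₁ hne hx₁ hvy hP
  rw [hu₂] at hU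
  generalize isoNumU (φ a) (φ b) κ (x₁ * v) v = N at *
  generalize isoDen (φ a) (φ b) κ w (x₁ * v) v = D at *
  generalize kernelForm (φ b) κ (x₁ * v) v = ε at *
  have hN' : x * ε ^ 2 = N := by
    refine mul_left_cancel₀ hε ?_
    linear_combination hU - x * hV
  refine mul_right_cancel₀ (pow_ne_zero 2 hε) ?_
  linear_combination hN + 3 * hN'

end NormMap

section SecondIsogeny

variable {R : Type} [CommRing R] {a b a₂ b₂ κ w : R} (φ : R →+* K)

/-- Some point of order three outside the kernel has its image in the `uv`-chart, away from the
identity, with `x + b³ = b⁴ κ / 3`. -/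
lemma PointedMap.Represents.exists_image [IsAlgClosed K] [DecidableEq K]
    {ψ : PointedMap a b a₂ b₂} (hψ : ψ.Represents κ w) (hp : IsogenyParam a b κ w)
    (h : GoodFibre (φ a) (φ b)) (ha₂ : a₂ = a ^ 3 * w ^ 4) (hb₂ : b₂ = b ^ 3) :
    ∃ (T : FibrePoint φ a b) (x y : K) (hn : (curve (φ a₂) (φ b₂)).toAffine.Nonsingular x y),
      3 • T = 0 ∧ ψ.MapsTo φ T (.some x y hn) ∧ 3 * (x + φ b ^ 3) = φ b ^ 4 * φ κ := by
  have hp' := hp.map φ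
  obtain ⟨κ₁, w₁, hp₁, hne⟩ := exists_param_ne h hp'
  obtain ⟨x₁, y₁, hn₁, hx₁⟩ := exists_kernel_point h (hp₁.κ_ne_zero h)
  have hP := curve_equation_iff.mp hn₁.1
  have hy₁ : y₁ ≠ 0 := by
    rintro rfl
    have hX : κ₁ * x₁ = -(1 + φ b * κ₁) := by linear_combination hx₁
    have : (κ₁ * x₁) ^ 2 * (κ₁ * (x₁ + φ b)) = 0 := by linear_combination -κ₁ ^ 3 * hP
    rw [hx₁, hX] at this
    exact pow_ne_zero 2 hp₁.j_ne_zero (by linear_combination -this)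
  obtain ⟨v, hvy⟩ : ∃ v, v * y₁ = 1 := ⟨y₁⁻¹, inv_mul_cancel₀ hy₁⟩
  obtain ⟨hε, hD⟩ := iso_ne_zero_of_three_torsion h hp' hp₁ hne hx₁ hvy hP
  have hN := isoNumU_of_three_torsion h hp' hp₁ hne hx₁ hvy hP
  have hc : v + φ a * (x₁ * v) * v + φ a * φ b * v ^ 2 =
      (x₁ * v) ^ 3 + φ b * (x₁ * v) ^ 2 * v := by
    linear_combination v ^ 3 * hP - (v + φ a * x₁ * v ^ 2 + φ a * φ b * v ^ 2 + v ^ 2 * y₁) * hvy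
  have hE := isoDen_equation hp' hc
  have hD' := eval₂_isoD (a := a) (b := b) (κ := κ) (w := w) φ (x₁ * v) v
  have hU' := eval₂_isoU (a := a) (b := b) (κ := κ) φ (x₁ * v) v
  have hV' := eval₂_isoV (b := b) (κ := κ) φ (x₁ * v) v
  have hg := h.target hp'
  rw [← map_pow, ← map_pow φ w, ← map_mul, ← map_pow, ← ha₂, ← hb₂] at hg
  refine ⟨.some x₁ y₁ hn₁, isoNumU (φ a) (φ b) (φ κ) (x₁ * v) v /
      kernelForm (φ b) (φ κ) (x₁ * v) v ^ 2,
    isoDen (φ a) (φ b) (φ κ) (φ w) (x₁ * v) v /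
      kernelForm (φ b) (φ κ) (x₁ * v) v ^ 3, hg.nonsingular ?_,
    three_nsmul_eq_zero h hp₁ hx₁ hn₁,
    ⟨x₁ * v, v,
      kernelForm (φ b) (φ κ) (x₁ * v) v *
        isoNumU (φ a) (φ b) (φ κ) (x₁ * v) v /
        isoDen (φ a) (φ b) (φ κ) (φ w) (x₁ * v) v,
      kernelForm (φ b) (φ κ) (x₁ * v) v ^ 3 /
        isoDen (φ a) (φ b) (φ κ) (φ w) (x₁ * v) v, ⟨hvy, rfl⟩, ⟨?_, ?_⟩,
      ⟨_, _, hψ.u, ?_, ?_⟩, ⟨_, _, hψ.v, ?_, ?_⟩⟩, ?_⟩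
  · rw [ha₂, hb₂, map_mul, map_pow, map_pow, map_pow]
    generalize isoNumU (φ a) (φ b) (φ κ) (x₁ * v) v = N at *
    generalize isoDen (φ a) (φ b) (φ κ) (φ w) (x₁ * v) v = D at *
    generalize kernelForm (φ b) (φ κ) (x₁ * v) v = ε at *
    field_simp
    linear_combination hE
  · generalize isoNumU (φ a) (φ b) (φ κ) (x₁ * v) v = N at *
    generalize isoDen (φ a) (φ b) (φ κ) (φ w) (x₁ * v) v = D at *
    generalize kernelForm (φ b) (φ κ) (x₁ * v) v = ε at *
    field_simp
  · generalize isoNumU (φ a) (φ b) (φ κ) (x₁ * v) v = N at *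
    generalize isoDen (φ a) (φ b) (φ κ) (φ w) (x₁ * v) v = D at *
    generalize kernelForm (φ b) (φ κ) (x₁ * v) v = ε at *
    field_simp
  · rw [hD']; exact hD
  · rw [hD', hU']
    exact mul_div_cancel₀ _ hD
  · rw [hD']; exact hD
  · rw [hD', hV']
    exact mul_div_cancel₀ _ hD
  · generalize isoNumU (φ a) (φ b) (φ κ) (x₁ * v) v = N at *
    generalize kernelForm (φ b) (φ κ) (x₁ * v) v = ε at *
    field_simp
    linear_combination hN

end SecondIsogeny

end Uniqueness

/-! ### The universal parameter and the generic points of `S₃` -/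

section BaseRing

lemma inverse_eq_of_mul_eq_one {R : Type} [CommRing R] {x y : R} (h : x * y = 1) :
    Ring.inverse x = y := by
  obtain ⟨u, rfl⟩ := IsUnit.of_mul_eq_one _ h
  rw [Ring.inverse_unit]
  exact Units.inv_eq_of_mul_eq_one_right h

instance : IsDomain ZQuarter :=
  IsLocalization.isDomain_localization
    (powers_le_nonZeroDivisors_of_noZeroDivisors (by norm_num))

instance : CharZero ZQuarter := by
  refine charZero_of_injective_algebraMap (R := ℤ) ?_
  exact IsLocalization.injective ZQuarter
    (powers_le_nonZeroDivisors_of_noZeroDivisors (by norm_num : (4 : ℤ) ≠ 0))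

lemma disc_ne_zero : disc ≠ 0 := by
  intro h
  have h1 := congrArg (MvPolynomial.eval fun _ => (1 : ZQuarter)) h
  simp [disc] at h1
  norm_num at h1

instance : IsDomain S :=
  IsLocalization.isDomain_localization
    (powers_le_nonZeroDivisors_of_noZeroDivisors disc_ne_zero)

instance : CharZero S := by
  have h : Function.Injective (algebraMap (MvPolynomial (Fin 2) ZQuarter) S) :=
    IsLocalization.injective (M := Submonoid.powers disc) S
      (powers_le_nonZeroDivisors_of_noZeroDivisors disc_ne_zero)
  exact charZero_of_injective_ringHom h

lemma two_ne_zero_of_hom {K : Type} [Field K] (φ : S3 →+* K) : (2 : K) ≠ 0 := by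
  intro h
  have h4 : IsUnit (algebraMap ℤ ZQuarter 4) := IsLocalization.Away.algebraMap_isUnit _
  have h5 := (h4.map (algebraMap ZQuarter S)).map (φ.comp (AdjoinRoot.of polyW))
  rw [map_ofNat, map_ofNat, map_ofNat] at h5
  exact h5.ne_zero (by linear_combination 2 * h)

lemma goodFibre {K : Type} [Field K] (φ : S3 →+* K) (h3 : (3 : K) ≠ 0) :
    GoodFibre (φ a) (φ b) := by
  refine ⟨two_ne_zero_of_hom φ, h3, (isUnit_a.map φ).ne_zero, (isUnit_b.map φ).ne_zero, ?_⟩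
  have h := (isUnit_disc.map (φ.comp (AdjoinRoot.of polyW))).ne_zero
  rw [map_mul, map_sub, map_mul _ 16, map_ofNat, map_pow _ aS 2] at h
  exact right_ne_zero_of_mul h

end BaseRing

section Parameters

/-- The quartic equation of `κ` says exactly that `κ` is the parameter of an isogeny, when `a` is
invertible. The target coefficient `a³ w⁴` is then a polynomial in `κ`, divided by `a`. -/
lemma IsogenyParam.exists_of_quartic {R : Type} [CommRing R] {a b κ α : R} (hα : a * α = 1)
    (hQ : b ^ 4 * κ ^ 4 - 6 * b ^ 2 * κ ^ 2 + (a ^ 2 - 8 * b) * κ - 3 = 0) :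
    ∃ w, IsogenyParam a b κ w ∧
      b + a ^ 2 * w ^ 3 = b ^ 4 * κ ^ 3 - 6 * b ^ 2 * κ + (a ^ 2 - 8 * b) ∧
      a ^ 3 * w ^ 4 = α * ((a ^ 2 * b ^ 4 - 4 * b ^ 5) * κ ^ 3 + 4 * b ^ 4 * κ ^ 2 +
        (-6 * a ^ 2 * b ^ 2 + 20 * b ^ 3) * κ + a ^ 4 - 12 * a ^ 2 * b + 12 * b ^ 2) := by
  obtain ⟨w, hw⟩ : ∃ w, w = α ^ 2 * (a ^ 2 - b * (3 - b * κ) * (1 + b * κ) ^ 2) := ⟨_, rfl⟩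
  have hα2 : a ^ 2 * α ^ 2 = 1 := by rw [← mul_pow, hα, one_pow]
  have h1 : (1 + b * κ) * w = 1 := by
    rw [hw]
    linear_combination hα2 + b * α ^ 2 * hQ
  obtain ⟨t, ht⟩ : ∃ t, t = b ^ 4 * κ ^ 3 - 6 * b ^ 2 * κ + (a ^ 2 - 8 * b) := ⟨_, rfl⟩
  have h2 : (t - b) * (1 + b * κ) ^ 3 = a ^ 2 := by
    rw [ht]
    linear_combination b * ((b * κ) ^ 2 + 3 * (b * κ) + 3) * hQ
  have h3 : b + a ^ 2 * w ^ 3 = t := by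
    calc _ = b + (t - b) * ((1 + b * κ) * w) ^ 3 := by rw [← h2]; ring
      _ = t := by rw [h1]; ring
  refine ⟨w, ⟨h1, ?_⟩, h3.trans ht, ?_⟩
  · rw [h3, ht]
    linear_combination hQ
  · -- `a⁴ w⁴` is the square of `(t - b) (1 + b κ)`, by the formula for `a²` in `h2`
    have h4 : (t - b) * (1 + b * κ) = a ^ 2 + b * ((b * κ) ^ 3 - 7 * (b * κ) - 6) := by
      rw [ht]
      linear_combination b * hQ
    have h5 : a ^ 4 * w ^ 4 = ((t - b) * (1 + b * κ)) ^ 2 := by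
      calc _ = ((t - b) * (1 + b * κ)) ^ 2 * ((1 + b * κ) * w) ^ 4 := by
            linear_combination -w ^ 4 * (a ^ 2 + (t - b) * (1 + b * κ) ^ 3) * h2
        _ = _ := by rw [h1]; ring
    rw [h4] at h5
    linear_combination α * h5 - a ^ 3 * w ^ 4 * hα +
      α * b ^ 2 * ((b * κ) ^ 2 - 8) * hQ

/-- The values of `W`, with the denominator `b⁴` cleared. -/
lemma eval₂_polyW {L : Type} [CommRing L] (i : S →+* L) (r : L) :
    i bS ^ 4 * polyW.eval₂ i r =
      i bS ^ 4 * r ^ 4 - 6 * i bS ^ 2 * r ^ 2 + (i aS ^ 2 - 8 * i bS) * r - 3 := by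
  obtain ⟨β, hβ⟩ := isUnit_bS.exists_right_inv
  rw [polyW, inverse_eq_of_mul_eq_one (y := β ^ 2) (by rw [← mul_pow, hβ, one_pow]),
    inverse_eq_of_mul_eq_one (y := β ^ 4) (by rw [← mul_pow, hβ, one_pow])]
  simp only [Polynomial.eval₂_sub, Polynomial.eval₂_add, Polynomial.eval₂_mul,
    Polynomial.eval₂_pow, Polynomial.eval₂_X, Polynomial.eval₂_C, Polynomial.eval₂_ofNat, map_mul,
    map_pow, map_sub,
    map_ofNat]
  have hβ' := congrArg i hβ
  rw [map_mul, map_one] at hβ'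
  generalize i β = β' at *
  generalize i bS = b at *
  have h2 : b ^ 2 * β' ^ 2 = 1 := by rw [← mul_pow, hβ', one_pow]
  have h4 : b ^ 4 * β' ^ 4 = 1 := by rw [← mul_pow, hβ', one_pow]
  linear_combination -6 * b ^ 2 * r ^ 2 * h2 + ((i aS ^ 2 - 8 * b) * r - 3) * h4

lemma quartic_κ : b ^ 4 * κ ^ 4 - 6 * b ^ 2 * κ ^ 2 + (a ^ 2 - 8 * b) * κ - 3 = 0 := by
  have h := eval₂_polyW (AdjoinRoot.of polyW) (AdjoinRoot.root polyW)
  rw [AdjoinRoot.eval₂_root, mul_zero] at h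
  exact h.symm

/-- The element `κ` of `S₃` is a parameter for the universal curve, and `a'` is the coefficient of
the corresponding target. -/
lemma exists_universal_param : ∃ w : S3, IsogenyParam a b κ w ∧
    b + a ^ 2 * w ^ 3 = b ^ 4 * κ ^ 3 - 6 * b ^ 2 * κ + (a ^ 2 - 8 * b) ∧
    a' = a ^ 3 * w ^ 4 := by
  obtain ⟨α, hα⟩ := isUnit_a.exists_right_inv
  obtain ⟨w, hw, h1, h2⟩ := IsogenyParam.exists_of_quartic hα quartic_κ
  refine ⟨w, hw, h1, ?_⟩
  rw [a', inverse_eq_of_mul_eq_one hα]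
  exact h2.symm

end Parameters

section GeometricPoints

/-- An algebraic closure of the field of fractions of `S`. -/
abbrev GeomField : Type := AlgebraicClosure (FractionRing S)

lemma injective_algebraMap_geomField : Function.Injective (algebraMap S GeomField) := by
  rw [IsScalarTower.algebraMap_eq S (FractionRing S) GeomField]
  exact (algebraMap (FractionRing S) GeomField).injective.comp
    (IsFractionRing.injective S (FractionRing S))

instance : CharZero GeomField :=
  charZero_of_injective_ringHom injective_algebraMap_geomField

/-- The values of the derivative of `W`, with the denominator `b⁴` cleared. -/
lemma eval₂_derivative_polyW {L : Type} [CommRing L] (i : S →+* L) (r : L) :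
    i bS ^ 4 * (Polynomial.derivative polyW).eval₂ i r =
      4 * i bS ^ 4 * r ^ 3 - 12 * i bS ^ 2 * r + (i aS ^ 2 - 8 * i bS) := by
  obtain ⟨β, hβ⟩ := isUnit_bS.exists_right_inv
  rw [polyW, inverse_eq_of_mul_eq_one (y := β ^ 2) (by rw [← mul_pow, hβ, one_pow]),
    inverse_eq_of_mul_eq_one (y := β ^ 4) (by rw [← mul_pow, hβ, one_pow])]
  simp only [Polynomial.derivative_sub, Polynomial.derivative_add, Polynomial.derivative_X_pow,
    Polynomial.derivative_C_mul, Polynomial.derivative_X, Polynomial.derivative_C]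
  simp only [Polynomial.eval₂_sub, Polynomial.eval₂_add, Polynomial.eval₂_mul,
    Polynomial.eval₂_one, Polynomial.eval₂_zero, Polynomial.eval₂_pow, Polynomial.eval₂_X,
    Polynomial.eval₂_C, Polynomial.eval₂_ofNat, Polynomial.eval₂_natCast, map_mul, map_pow,
    map_sub, map_ofNat, map_natCast]
  have hβ' := congrArg i hβ
  rw [map_mul, map_one] at hβ'
  generalize i β = β' at *
  generalize i bS = b at *
  have h2 : b ^ 2 * β' ^ 2 = 1 := by rw [← mul_pow, hβ', one_pow]
  have h4 : b ^ 4 * β' ^ 4 = 1 := by rw [← mul_pow, hβ', one_pow]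
  push_cast
  linear_combination -12 * b ^ 2 * r * h2 + (i aS ^ 2 - 8 * b) * h4

lemma natDegree_polyW : polyW.natDegree = 4 := by
  rw [polyW]
  compute_degree!

lemma monic_polyW : polyW.Monic := by
  rw [polyW]
  monicity!

/-- `W` has no double root: at such a root `(b² κ² - 1)² = 0`, hence `a² = 16 b` or `a = 0`. -/
lemma separable_map_polyW : (polyW.map (algebraMap S GeomField)).Separable := by
  rw [Polynomial.separable_def,
    Polynomial.isCoprime_iff_aeval_ne_zero_of_isAlgClosed GeomField GeomField]
  intro r
  by_contra! h
  obtain ⟨h0, h1⟩ := h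
  rw [Polynomial.derivative_map] at h1
  rw [Polynomial.coe_aeval_eq_eval, Polynomial.eval_map] at h0 h1
  have e0 := eval₂_polyW (algebraMap S GeomField) r
  have e1 := eval₂_derivative_polyW (algebraMap S GeomField) r
  have ha := (isUnit_aS.map (algebraMap S GeomField)).ne_zero
  have hd := (isUnit_disc.map (algebraMap S GeomField)).ne_zero
  rw [map_mul, map_sub, map_mul _ 16, map_ofNat, map_pow _ aS 2] at hd
  replace hd := right_ne_zero_of_mul hd
  rw [h0, mul_zero] at e0
  rw [h1, mul_zero] at e1
  generalize algebraMap S GeomField aS = a at *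
  generalize algebraMap S GeomField bS = b at *
  have e2 : (3 : GeomField) * ((b * r - 1) * (b * r + 1)) ^ 2 = 0 := by
    linear_combination e0 - r * e1
  have e3 := pow_eq_zero_iff (n := 2) (by norm_num) |>.mp
    ((mul_eq_zero.mp e2).resolve_left (by norm_num))
  rcases mul_eq_zero.mp e3 with e4 | e4
  · refine hd ?_
    linear_combination -e1 - (4 * b * ((b * r) ^ 2 + b * r + 1) - 12 * b) * e4
  · refine pow_ne_zero 2 ha ?_
    linear_combination -e1 - (4 * b * ((b * r) ^ 2 - b * r + 1) - 12 * b) * e4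

/-- The geometric generic points of `S₃` detect whether an element vanishes: `S₃` is free with
basis `1, κ, κ², κ³` over the domain `S`, and `W` has four distinct roots in `GeomField`. -/
lemma eq_zero_of_forall_hom {z : S3} (hz : ∀ φ : S3 →+* GeomField, φ z = 0) : z = 0 := by
  obtain ⟨p, rfl⟩ := AdjoinRoot.mk_surjective z
  have hmk : AdjoinRoot.mk polyW p = AdjoinRoot.mk polyW (p %ₘ polyW) := by
    conv_lhs => rw [← Polynomial.modByMonic_add_div p polyW]
    rw [map_add, map_mul, AdjoinRoot.mk_self, zero_mul, add_zero]
  have hdeg : (p %ₘ polyW).natDegree < 4 := by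
    rw [← natDegree_polyW]
    refine Polynomial.natDegree_modByMonic_lt p monic_polyW fun h => ?_
    have := natDegree_polyW
    rw [h, Polynomial.natDegree_one] at this
    exact absurd this (by norm_num)
  rw [hmk] at hz ⊢
  generalize p %ₘ polyW = q at *
  by_contra hq
  have hq0 : q.map (algebraMap S GeomField) ≠ 0 := by
    rw [Ne, Polynomial.map_eq_zero_iff injective_algebraMap_geomField]
    rintro rfl
    exact hq (map_zero _)
  have hsub : (polyW.map (algebraMap S GeomField)).roots ≤
      (q.map (algebraMap S GeomField)).roots := by
    refine (Multiset.le_iff_subset (Polynomial.nodup_roots separable_map_polyW)).mpr ?_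
    intro r hr
    have hr' := Polynomial.isRoot_of_mem_roots hr
    rw [Polynomial.IsRoot.def, Polynomial.eval_map] at hr'
    have h := hz (AdjoinRoot.lift (algebraMap S GeomField) r hr')
    rw [AdjoinRoot.lift_mk] at h
    rwa [Polynomial.mem_roots hq0, Polynomial.IsRoot.def, Polynomial.eval_map]
  have hcard := Multiset.card_le_card hsub
  rw [IsAlgClosed.card_roots_eq_natDegree, monic_polyW.natDegree_map, natDegree_polyW] at hcard
  have h1 := Polynomial.card_roots' (q.map (algebraMap S GeomField))
  have h2 := Polynomial.natDegree_map_le (f := algebraMap S GeomField) (p := q)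
  omega

end GeometricPoints

section Isogenies

variable {a'' b'' : S3} {ψ : PointedMap a b a' b'} {ψ' : PointedMap a' b' a'' b''} {w : S3}

lemma PointedMap.Represents.isUniversalIsogeny (hw : IsogenyParam a b κ w)
    (hψ : ψ.Represents κ w) (hκ : ψ.HasCotangentFactor κ) : IsUniversalIsogeny ψ := by
  refine ⟨fun K _ _ _ φ h3 => ?_, hκ⟩
  have hg := goodFibre φ h3
  obtain ⟨X, z, hn, hX⟩ := exists_kernel_point hg ((hw.map φ).κ_ne_zero hg)
  exact ⟨.some X z hn, hψ.isNormMap φ hw hg hX⟩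

lemma goodFibre_target {K : Type} [Field K] (φ : S3 →+* K) (h3 : (3 : K) ≠ 0)
    (hw : IsogenyParam a b κ w) (ha' : a' = a ^ 3 * w ^ 4) : GoodFibre (φ a') (φ b') := by
  have h := (goodFibre φ h3).target (hw.map φ)
  rwa [← map_pow, ← map_pow φ w, ← map_mul, ← map_pow, ← ha'] at h

lemma PointedMap.Represents.isSecondIsogeny (hw : IsogenyParam a b κ w)
    (ha' : a' = a ^ 3 * w ^ 4) (hψ : ψ.Represents κ w) {κ' w' : S3}
    (hw' : IsogenyParam a' b' κ' w') (hψ' : ψ'.Represents κ' w')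
    (hκ' : b ^ 4 * κ * κ' + 3 = 0) : IsSecondIsogeny ψ ψ' := by
  intro K _ _ _ φ h3
  obtain ⟨T, x, y, hn, hT, hTQ, hx⟩ := hψ.exists_image φ hw (goodFibre φ h3) ha' rfl
  refine ⟨T, .some x y hn, hT, hTQ, WeierstrassCurve.Affine.Point.some_ne_zero hn,
    hψ'.isNormMap φ hw' (goodFibre_target φ h3 hw ha') (mul_left_cancel₀ h3 ?_)⟩
  have h := congrArg φ hκ'
  simp only [map_add, map_mul, map_pow, map_ofNat, map_zero] at h
  rw [b', map_pow]
  linear_combination φ κ' * hx + h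

/-- On each geometric fibre, the point `Q'` has parameter `-3 / (b⁴ κ)`. -/
lemma IsSecondIsogeny.map_cotangentFactor_eq (hψ : IsUniversalIsogeny ψ)
    (hψ' : IsSecondIsogeny ψ ψ') (hw : IsogenyParam a b κ w) (ha' : a' = a ^ 3 * w ^ 4)
    {κ' : S3} (hκ' : ψ'.HasCotangentFactor κ') {K : Type} [Field K] [IsAlgClosed K]
    (φ : S3 →+* K) (h3 : (3 : K) ≠ 0) : φ (b ^ 4 * κ * κ' + 3) = 0 := by
  classical
  have hg := goodFibre φ h3
  obtain ⟨Q, hQ⟩ := hψ.1 K φ h3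
  obtain ⟨X, z, hn, κ₀, w₀, rfl, hp, hX⟩ := exists_param_of_three_nsmul hg hQ.1 hQ.2.1
  have hκ := hQ.cotangentFactor_eq hg hp hX hψ.2
  rw [← hκ] at hp hX
  have hw₀ := (hw.map φ).w_eq hp
  obtain ⟨T, Q', hT, hTQ, hQ0, hQ'⟩ := hψ' K φ h3
  obtain ⟨x, y, hn', κ₁, w₁, rfl, hp₁, hx⟩ :=
    exists_param_of_three_nsmul (goodFibre_target φ h3 hw ha') hQ0 hQ'.2.1
  have h := hQ.image_three_torsion hg hp hX (by rw [ha', map_mul, map_pow, map_pow, hw₀])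
    (map_pow φ b 3) hT hTQ
  rw [← hQ'.cotangentFactor_eq (goodFibre_target φ h3 hw ha') hp₁ hx hκ', b', map_pow] at hx
  simp only [map_add, map_mul, map_pow, map_ofNat]
  linear_combination 3 * hx - φ κ' * h

/-- As `b⁴ κ κ' = -3` in `S₃`, and `κ` divides the nonzerodivisor `3`, the factor `κ'` is a
polynomial in `κ` by the quartic equation. -/
lemma cotangentFactor_eq_of_mul_eq {κ' : S3} (h : b ^ 4 * κ * κ' + 3 = 0) :
    κ' = -κ ^ 3 + 6 * Ring.inverse (b ^ 2) * κ - (a ^ 2 - 8 * b) * Ring.inverse (b ^ 4) := by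
  obtain ⟨β, hβ⟩ := isUnit_b.exists_right_inv
  have h2 : b ^ 2 * β ^ 2 = 1 := by rw [← mul_pow, hβ, one_pow]
  have h4 : b ^ 4 * β ^ 4 = 1 := by rw [← mul_pow, hβ, one_pow]
  rw [inverse_eq_of_mul_eq_one h2, inverse_eq_of_mul_eq_one h4]
  have e : κ * (κ' - (-κ ^ 3 + 6 * β ^ 2 * κ - (a ^ 2 - 8 * b) * β ^ 4)) = 0 := by
    linear_combination β ^ 4 * h - (κ * κ' + κ ^ 4) * h4 + β ^ 4 * quartic_κ +
      6 * β ^ 2 * κ ^ 2 * h2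
  have h3 : (3 : S3) * (κ' - (-κ ^ 3 + 6 * β ^ 2 * κ - (a ^ 2 - 8 * b) * β ^ 4)) = 0 := by
    linear_combination (κ' - (-κ ^ 3 + 6 * β ^ 2 * κ - (a ^ 2 - 8 * b) * β ^ 4)) * h -
      b ^ 4 * κ' * e
  rw [← sub_eq_zero]
  refine eq_zero_of_forall_hom fun φ => ?_
  have h5 := congrArg φ h3
  rw [map_mul, map_ofNat, map_zero] at h5
  exact (mul_eq_zero.mp h5).resolve_left (by norm_num)

end Isogenies

end

end FrobIsog

theorem mainTheorem5 :
    (∃ (ψ : FrobIsog.PointedMap FrobIsog.a FrobIsog.b FrobIsog.a' FrobIsog.b')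
      (a'' b'' : FrobIsog.S3)
      (ψ' : FrobIsog.PointedMap FrobIsog.a' FrobIsog.b' a'' b''),
      FrobIsog.IsUniversalIsogeny ψ ∧ FrobIsog.IsSecondIsogeny ψ ψ') ∧
    ∀ (ψ : FrobIsog.PointedMap FrobIsog.a FrobIsog.b FrobIsog.a' FrobIsog.b')
      (a'' b'' : FrobIsog.S3)
      (ψ' : FrobIsog.PointedMap FrobIsog.a' FrobIsog.b' a'' b''),
      FrobIsog.IsUniversalIsogeny ψ → FrobIsog.IsSecondIsogeny ψ ψ' →
        (∃! κ' : FrobIsog.S3, ψ'.HasCotangentFactor κ') ∧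
        ∀ κ' : FrobIsog.S3, ψ'.HasCotangentFactor κ' →
          FrobIsog.b ^ 4 * FrobIsog.κ * κ' + 3 = 0 ∧
          κ' = -FrobIsog.κ ^ 3 + 6 * Ring.inverse (FrobIsog.b ^ 2) * FrobIsog.κ -
            (FrobIsog.a ^ 2 - 8 * FrobIsog.b) * Ring.inverse (FrobIsog.b ^ 4) := by
  obtain ⟨w, hw, ht, ha'⟩ := FrobIsog.exists_universal_param
  obtain ⟨α, hα⟩ := FrobIsog.isUnit_a.exists_right_inv
  obtain ⟨β, hβ⟩ := FrobIsog.isUnit_b.exists_right_inv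
  refine ⟨?_, fun ψ a'' b'' ψ' hψ hψ' =>
    ⟨ψ'.existsUnique_cotangentFactor, fun κ' hκ' => ?_⟩⟩
  · obtain ⟨ψ, hψ, hκ⟩ := FrobIsog.exists_represents hw ha' (rfl : FrobIsog.b' = _)
    have hw' := hw.dual hα hβ
    rw [← ha'] at hw'
    obtain ⟨ψ', hψ', -⟩ := FrobIsog.exists_represents hw' rfl rfl
    refine ⟨ψ, _, _, ψ', hψ.isUniversalIsogeny hw hκ, hψ.isSecondIsogeny hw ha' hw' hψ' ?_⟩
    have hβ4 : FrobIsog.b ^ 4 * β ^ 4 = 1 := by rw [← mul_pow, hβ, one_pow]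
    linear_combination -hw.rel - FrobIsog.κ * (FrobIsog.b + FrobIsog.a ^ 2 * w ^ 3) * hβ4
  · have h : FrobIsog.b ^ 4 * FrobIsog.κ * κ' + 3 = 0 := FrobIsog.eq_zero_of_forall_hom
      fun φ => hψ'.map_cotangentFactor_eq hψ hw ha' hκ' φ (by norm_num)
    exact ⟨h, FrobIsog.cotangentFactor_eq_of_mul_eq h⟩
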